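/- Let $\lambda>0$ and let $c:\mathbb R\to(0,\infty)$ be measurable with $1/c$ integrable on bounded intervals. Put $\tau(x)=\int_0^x\frac{dw}{c(w)}$ and $D_t=\{x:|\tau(x)|<t\}$, and let $I_0(z)=\sum_{k\ge0}\frac{(z/2)^{2k}}{(k!)^2}$ be the modified Bessel function of order zero. Fix $t>0$ and consider a particle that starts at the origin and, during $[0,t]$, moves with velocity $V(s)\,c(\text{position})$ (equation of motion in integral form), where $V(s)\in\{-1,1\}$ changes sign at the events of a non-homogeneous Poisson process on $(0,\infty)$ with rate $\lambda(s)$. (i) Let $\lambda(s)=\lambda\tanh\lambda s$, with $V(0)=\pm1$ with probability $\frac12$ each, independent of the Poisson process. Then there are points $a,b$ with $\tau(a)=-t$, $\tau(b)=t$, and the position $Y(t)$ has an atom of mass $\frac1{2\cosh\lambda t}$ at each of $a$ and $b$; the rest of its law is absolutely continuous with density $$p_Y(x,t)=\frac{1}{2c(x)\cosh\lambda t}\,\frac{\partial}{\partial t}I_0\Big(\lambda\sqrt{t^2-|\tau(x)|^2}\Big),\qquad x\in D_t .$$ (ii) Let $\lambda(s)=\lambda\coth\lambda s$ (the events accumulate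 at time $0$, so there is no initial direction; at every time $s>0$, $V(s)=\pm1$ with probability $\frac12$ each, independently of the events after $s$). Then the law of the position $X(t)$ is absolutely continuous with density $$p_X(x,t)=\frac{\lambda}{2c(x)\sinh\lambda t}\,I_0\Big(\lambda\sqrt{t^2-|\tau(x)|^2}\Big),\qquad x\in D_t .$$ (iii) At all $(x,t)$ with $|\tau(x)|<t$ such that $c$ is continuous in a neighbourhood of $x$, the functions $u=c\,p_Y$ and $u=c\,p_X$ (the densities with respect to $dx/c(x)$) are classical solutions of the telegraph equations $$\frac{\partial^2u}{\partial t^2}+2\lambda\tanh(\lambda t)\frac{\partial u}{\partial t}=c(x)\frac{\partial}{\partial x}\Big(c(x)\frac{\partial u}{\partial x}\Big),\qquad \frac{\partial^2u}{\partial t^2}+2\lambda\coth(\lambda t)\frac{\partial u}{\partial t}=c(x)\frac{\partial}{\partial x}\Big(c(x)\frac{\partial u}{\partial x}\Big)$$ respectively; equivalently, $p=p_Y$ and $p=p_X$ satisfy $\frac{\partial^2p}{\partial t^2}+2\lambda(t)\frac{\partial p}{\partial t}=\frac{\partial}{\partial x}\big(c(x)\frac{\partial}{\partial x}(c(x)p)\big)$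 with $\lambda(t)=\lambda\tanh\lambda t$ and $\lambda\coth\lambda t$ respectively. -/

import Mathlib

open MeasureTheory ProbabilityTheory Filter Topology

namespace Telegraph

noncomputable section

/-- The modified Bessel function of the first kind of order zero. -/
def besselI0 (z : ℝ) : ℝ := ∑' k : ℕ, (z / 2) ^ (2 * k) / ((k.factorial : ℝ) ^ 2)

/-- The signed travel time `∫_0^x dw / c(w)` from the origin to `x`. -/
def travelTime (c : ℝ → ℝ) (x : ℝ) : ℝ := ∫ w in (0 : ℝ)..x, 1 / c w

/-- The rate `λ tanh λt`. -/
def tanhRate (lam t : ℝ) : ℝ := lam * Real.tanh (lam * t)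

/-- The rate `λ coth λt`. -/
def cothRate (lam t : ℝ) : ℝ := lam * (Real.cosh (lam * t) / Real.sinh (lam * t))

/-- The number of points of the random set `S` in the time interval `(a, b]`. -/
def count {Ω : Type*} (S : Ω → Set ℝ) (a b : ℝ) (ω : Ω) : ℕ := (S ω ∩ Set.Ioc a b).ncard

/-- `S` is the set of event times of a non-homogeneous Poisson process on `(0, ∞)` with the given
rate. The rate need not be integrable at `0`; if it is not, the events accumulate at time `0`. -/
structure IsPoissonProcess {Ω : Type*} [MeasurableSpace Ω] (P : Measure Ω)
    (rate : ℝ → ℝ) (S : Ω → Set ℝ) : Prop where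
  locally_finite : ∀ᵐ ω ∂P, ∀ a b : ℝ, 0 < a → (S ω ∩ Set.Ioc a b).Finite
  poisson_law : ∀ a b : ℝ, 0 < a → a ≤ b →
    HasLaw (count S a b) (poissonMeasure (∫ s in a..b, rate s).toNNReal) P
  indep_increments : ∀ τ : ℕ → ℝ, 0 < τ 0 → Monotone τ →
    iIndepFun (fun i : ℕ => count S (τ i) (τ (i + 1))) P

/-- `V` is a symmetric direction process (with values `±1`) that is reversed at every point of `S`.
`I` is the set of reference times: at each `s ∈ I` the direction is `+1` or `-1` with probability
`1/2` each, independently of the reversals after time `s`, and the direction at any time `t ≥ s` is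
obtained from the one at time `s` by `N(s, t]` reversals. If the total rate near time `0` is finite
one takes `I = {0}` (a symmetric initial direction, independent of the Poisson process). If
reversals accumulate at time `0` there is no initial direction, and `I = (0, ∞)`. -/
structure IsDirection {Ω : Type*} [MeasurableSpace Ω] (P : Measure Ω)
    (I : Set ℝ) (S : Ω → Set ℝ) (V : ℝ → Ω → ℝ) : Prop where
  measurable : ∀ s, Measurable (V s)
  forward : ∀ s ∈ I, P {ω | V s ω = 1} = 1 / 2
  backward : ∀ s ∈ I, P {ω | V s ω = -1} = 1 / 2
  indep : ∀ s ∈ I, IndepFun (V s)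
    (fun ω (q : {q : ℝ × ℝ // s < q.1 ∧ q.1 ≤ q.2}) => count S q.1.1 q.1.2 ω) P
  reversal : ∀ᵐ ω ∂P, ∀ s ∈ I, ∀ t, s ≤ t → V t ω = V s ω * (-1) ^ count S s t ω

/-- `X` is, during the time interval `[0, T]`, the position of a particle that starts at the origin
and has velocity `V(s) c(X(s))` at time `s`, where the direction `V` is reversed at the events of a
Poisson process with the given rate. The equation of motion `dX = V c(X) ds` is in integral form. -/
structure IsTelegraphProcess {Ω : Type*} [MeasurableSpace Ω] (P : Measure Ω)
    (rate c : ℝ → ℝ) (I : Set ℝ) (T : ℝ) (S : Ω → Set ℝ) (V X : ℝ → Ω → ℝ) : Prop where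
  poisson : IsPoissonProcess P rate S
  direction : IsDirection P I S V
  measurable : ∀ s, Measurable (X s)
  motion : ∀ᵐ ω ∂P, ∀ t ∈ Set.Icc 0 T,
    IntervalIntegrable (fun s => V s ω * c (X s ω)) volume 0 t ∧
      X t ω = ∫ s in (0 : ℝ)..t, V s ω * c (X s ω)

/-- `(1 / (2 c(x) cosh λt)) ∂/∂t I_0(λ √(t² - |∫_0^x dw/c(w)|²))`. -/
def tanhDensity (lam : ℝ) (c : ℝ → ℝ) (x t : ℝ) : ℝ :=
  1 / (2 * c x * Real.cosh (lam * t)) *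
    deriv (fun s => besselI0 (lam * Real.sqrt (s ^ 2 - |travelTime c x| ^ 2))) t

/-- `(λ / (2 c(x) sinh λt)) I_0(λ √(t² - |∫_0^x dw/c(w)|²))`. -/
def cothDensity (lam : ℝ) (c : ℝ → ℝ) (x t : ℝ) : ℝ :=
  lam / (2 * c x * Real.sinh (lam * t)) *
    besselI0 (lam * Real.sqrt (t ^ 2 - |travelTime c x| ^ 2))

/-- The set of positions that are reached in less than the time `t`. -/
def support (c : ℝ → ℝ) (t : ℝ) : Set ℝ := {x | |travelTime c x| < t}

/-- At `(x, t)` all derivatives involved exist and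
`∂²u/∂t² + 2 rate(t) ∂u/∂t = c(x) ∂/∂x (c(x) ∂u/∂x)`. -/
def SolvesTelegraphAt (rate c : ℝ → ℝ) (u : ℝ → ℝ → ℝ) (x t : ℝ) : Prop :=
  (∀ᶠ s in 𝓝 t, DifferentiableAt ℝ (u x) s) ∧
  DifferentiableAt ℝ (deriv (u x)) t ∧
  (∀ᶠ z in 𝓝 x, DifferentiableAt ℝ (fun w => u w t) z) ∧
  DifferentiableAt ℝ (fun z => c z * deriv (fun w => u w t) z) x ∧
  deriv (deriv (u x)) t + 2 * rate t * deriv (u x) t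
    = c x * deriv (fun z => c z * deriv (fun w => u w t) z) x

/-- At `(x, t)` all derivatives involved exist and
`∂²p/∂t² + 2 rate(t) ∂p/∂t = ∂/∂x (c(x) ∂/∂x (c(x) p))`. -/
def SolvesForwardTelegraphAt (rate c : ℝ → ℝ) (p : ℝ → ℝ → ℝ) (x t : ℝ) : Prop :=
  (∀ᶠ s in 𝓝 t, DifferentiableAt ℝ (p x) s) ∧
  DifferentiableAt ℝ (deriv (p x)) t ∧
  (∀ᶠ z in 𝓝 x, DifferentiableAt ℝ (fun w => c w * p w t) z) ∧
  DifferentiableAt ℝ (fun z => c z * deriv (fun w => c w * p w t) z) x ∧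
  deriv (deriv (p x)) t + 2 * rate t * deriv (p x) t
    = deriv (fun z => c z * deriv (fun w => c w * p w t) z) x

end

end Telegraph

namespace Telegraph

noncomputable section

/-! The proof passes from position to signed travel time. Along a path, `travelTime c (X t)` equals
`∫_0^t V`, even for merely measurable `c` (`IsDirectionPath.travelTime_eq`), and `travelTime c` is
an injective measurable embedding. It therefore suffices to find the law of the displacement `Z_t =
∫_0^t V` of a particle with unit speed, and to transfer it back with `map_travelTime_withDensity`.

Both rates have the form `h' / h` with `h'' = λ² h`, where `h` is `cosh λt` or `sinh λt`. Put `M(t)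
= E exp(u Z_t)` and `W(t) = E (V_t exp(u Z_t))`. Then `M = 1 + u ∫ W`. Since the displacement up to
`s` is independent of the parity of the reversals in `(s, t]`, whose sign has mean `exp(-2 ∫_s^t
h'/h) = (h s / h t)²`, also `W(t) = u ∫_0^t (h s / h t)² M(s) ds`. These two equations give `(h M)''
= (u² + λ²) h M`, so `h M = h(0) cosh κt + h'(0) sinh κt / κ` with `κ = √(u² + λ²)`
(`IsRateProfile.solution_unique`, `IsRegularDirection.integral_exp`).

The exponential moments of the Bessel densities are computed independently: expanding `cosh` and the
Bessel series turns them into beta integrals, and the binomial theorem sums these to `cosh κt` or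
`sinh κt / κ` (`integral_exp_mul_besselSeries_zero`, `integral_exp_mul_besselSeries_one`). As the
displacement is bounded, the moments determine the law (`ext_of_integral_exp`).

The differential equations are separate: `c p = g / h`, where `g` solves `g_tt - g_zz = λ² g` in
time and travel time, and `c ∂/∂x` is differentiation in travel time (`solves_of_quotient`). -/

/-! ### Bessel series without square roots -/

/-- The entire function `∑ w ^ k / (k! (k + m)!)`; up to a power of `w` it is the modified Bessel
function of order `m` at `2 √w`. -/
def besselSeries (m : ℕ) (w : ℝ) : ℝ :=
  ∑' k : ℕ, w ^ k / ((k.factorial : ℝ) * ((k + m).factorial : ℝ))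

theorem summable_besselSeries (m : ℕ) (w : ℝ) :
    Summable fun k : ℕ => w ^ k / ((k.factorial : ℝ) * ((k + m).factorial : ℝ)) := by
  refine Summable.of_norm_bounded (Real.summable_pow_div_factorial |w|) fun k => ?_
  have h : (1 : ℝ) ≤ ((k + m).factorial : ℝ) := by exact_mod_cast Nat.factorial_pos (k + m)
  have hk : (0 : ℝ) < k.factorial := by positivity
  rw [norm_div, norm_pow, Real.norm_eq_abs, Real.norm_eq_abs,
    abs_of_pos (mul_pos hk (one_pos.trans_le h))]
  gcongr
  exact le_mul_of_one_le_right hk.le h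

theorem besselSeries_nonneg (m : ℕ) {w : ℝ} (hw : 0 ≤ w) : 0 ≤ besselSeries m w :=
  tsum_nonneg fun k => by positivity

/-- Differentiation term by term: the differentiated terms, shifted by one index, are those of order
`m + 1`, and on the ball of radius `|w| + 1` they are dominated by their values at that radius. -/
theorem hasDerivAt_besselSeries (m : ℕ) (w : ℝ) :
    HasDerivAt (besselSeries m) (besselSeries (m + 1) w) w := by
  set g' : ℕ → ℝ → ℝ := fun n y =>
    (n * y ^ (n - 1)) / ((n.factorial : ℝ) * ((n + m).factorial : ℝ)) with hg'
  set R : ℝ := |w| + 1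
  have hR : 0 < R := by positivity
  have hsucc : ∀ (n : ℕ) (y : ℝ), g' (n + 1) y =
      y ^ n / ((n.factorial : ℝ) * ((n + (m + 1)).factorial : ℝ)) := by
    intro n y
    have h1 : ((n + 1).factorial : ℝ) = (n + 1) * n.factorial := by
      exact_mod_cast Nat.factorial_succ n
    have h2 : n + 1 + m = n + (m + 1) := by ring
    simp only [hg', h1, h2, Nat.add_sub_cancel]
    push_cast
    have : ((n : ℝ) + 1) ≠ 0 := by positivity
    have : (n.factorial : ℝ) ≠ 0 := by positivity
    have : ((n + (m + 1)).factorial : ℝ) ≠ 0 := by positivity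
    field_simp
  have hsum : ∀ y, Summable fun n => g' n y := fun y =>
    (summable_nat_add_iff 1).1 (by simpa only [hsucc] using summable_besselSeries (m + 1) y)
  have key := hasDerivAt_tsum_of_isPreconnected (u := fun n => g' n R)
    (g := fun k y => y ^ k / ((k.factorial : ℝ) * ((k + m).factorial : ℝ))) (g' := g')
    (t := Metric.ball (0 : ℝ) R) (y₀ := w) (y := w) (hsum R) Metric.isOpen_ball
    (convex_ball _ _).isPreconnected (fun n y _ => by
      simpa [hg'] using (hasDerivAt_pow n y).div_const _)
    (fun n y hy => by
      have hy' : |y| ≤ R := by simpa using (Metric.mem_ball.1 hy).le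
      simp only [hg', norm_div, norm_mul, norm_pow, Real.norm_eq_abs]
      rw [abs_of_nonneg (by positivity : (0 : ℝ) ≤ (n : ℝ)),
        abs_of_nonneg (by positivity : (0 : ℝ) ≤ (n.factorial : ℝ)),
        abs_of_nonneg (by positivity : (0 : ℝ) ≤ ((n + m).factorial : ℝ))]
      gcongr)
    (by simp [R]) (summable_besselSeries m w) (by simp [R])
  rw [(hsum w).tsum_eq_zero_add] at key
  simp only [hsucc, show g' 0 w = 0 by simp [hg'], zero_add] at key
  exact key

theorem continuous_besselSeries (m : ℕ) : Continuous (besselSeries m) :=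
  continuous_iff_continuousAt.2 fun w => (hasDerivAt_besselSeries m w).continuousAt

/-- Since differentiation raises the order, this is Bessel's equation `w f'' + (m + 1) f' = f`. On
coefficients it is `(k + 1) + (m + 1) = k + m + 2`. -/
theorem besselSeries_recurrence (m : ℕ) (w : ℝ) :
    w * besselSeries (m + 2) w + (m + 1) * besselSeries (m + 1) w = besselSeries m w := by
  have h0 := (summable_besselSeries (m + 1) w)
  have h2 := (summable_besselSeries (m + 2) w)
  unfold besselSeries
  rw [h0.tsum_eq_zero_add, (summable_besselSeries m w).tsum_eq_zero_add, mul_add, ← tsum_mul_left,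
    ← tsum_mul_left, add_left_comm, ← (h2.mul_left w).tsum_add
      (((summable_nat_add_iff 1).2 h0).mul_left _)]
  congr 1
  · have : ((0 + (m + 1)).factorial : ℝ) = (m + 1) * (0 + m).factorial := by
      rw [zero_add, zero_add]; exact_mod_cast Nat.factorial_succ m
    rw [this]
    have : ((m : ℝ) + 1) ≠ 0 := by positivity
    have : ((0 + m).factorial : ℝ) ≠ 0 := by positivity
    simp
    field_simp
  · refine tsum_congr fun k => ?_
    have e1 : k + (m + 2) = k + 1 + m + 1 := by ring
    have e2 : k + 1 + (m + 1) = k + 1 + m + 1 := by ring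
    have h1 : ((k + 1).factorial : ℝ) = (k + 1) * k.factorial := by
      exact_mod_cast Nat.factorial_succ k
    have h3 : ((k + 1 + m + 1).factorial : ℝ) = (k + 1 + m + 1) * (k + 1 + m).factorial := by
      exact_mod_cast Nat.factorial_succ (k + 1 + m)
    rw [e1, e2, h3, h1]
    have : ((k : ℝ) + 1) ≠ 0 := by positivity
    have : (k.factorial : ℝ) ≠ 0 := by positivity
    have : ((k + 1 + m).factorial : ℝ) ≠ 0 := by positivity
    have : (k : ℝ) + 1 + m + 1 ≠ 0 := by positivity
    field_simp
    ring

/-- `I_0` is even, so the square root disappears and the density becomes an entire function of `t² -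
z²`, smooth up to and beyond `|z| = t`. -/
theorem besselI0_mul_sqrt (lam : ℝ) {w : ℝ} (hw : 0 ≤ w) :
    besselI0 (lam * Real.sqrt w) = besselSeries 0 (lam ^ 2 * w / 4) := by
  unfold besselI0 besselSeries
  refine tsum_congr fun k => ?_
  rw [pow_mul, div_pow, mul_pow, Real.sq_sqrt hw, add_zero, sq (k.factorial : ℝ)]
  norm_num

theorem besselI0_mul_sqrt_sub (lam : ℝ) {t z : ℝ} (h : |z| ≤ t) :
    besselI0 (lam * Real.sqrt (t ^ 2 - |z| ^ 2)) =
      besselSeries 0 (lam ^ 2 * (t ^ 2 - z ^ 2) / 4) := by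
  rw [besselI0_mul_sqrt lam (by nlinarith [abs_nonneg z]), sq_abs]

/-- Derivative in time of `s ↦ B_m (λ² (s² - z²) / 4)`. -/
theorem hasDerivAt_besselSeries_time (m : ℕ) (lam z t : ℝ) :
    HasDerivAt (fun s => besselSeries m (lam ^ 2 * (s ^ 2 - z ^ 2) / 4))
      (lam ^ 2 * t / 2 * besselSeries (m + 1) (lam ^ 2 * (t ^ 2 - z ^ 2) / 4)) t := by
  have h : HasDerivAt (fun s : ℝ => lam ^ 2 * (s ^ 2 - z ^ 2) / 4) (lam ^ 2 * t / 2) t := by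
    have := (((hasDerivAt_pow 2 t).sub_const (z ^ 2)).const_mul (lam ^ 2)).div_const 4
    refine this.congr_deriv ?_
    simp; ring
  rw [mul_comm]
  exact (hasDerivAt_besselSeries m _).comp t h

/-- Derivative in space of `y ↦ B_m (λ² (t² - y²) / 4)`. -/
theorem hasDerivAt_besselSeries_space (m : ℕ) (lam z t : ℝ) :
    HasDerivAt (fun y => besselSeries m (lam ^ 2 * (t ^ 2 - y ^ 2) / 4))
      (-(lam ^ 2 * z / 2) * besselSeries (m + 1) (lam ^ 2 * (t ^ 2 - z ^ 2) / 4)) z := by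
  have h : HasDerivAt (fun y : ℝ => lam ^ 2 * (t ^ 2 - y ^ 2) / 4) (-(lam ^ 2 * z / 2)) z := by
    have := (((hasDerivAt_pow 2 z).const_sub (t ^ 2)).const_mul (lam ^ 2)).div_const 4
    refine this.congr_deriv ?_
    simp; ring
  rw [mul_comm]
  exact (hasDerivAt_besselSeries m _).comp z h

/-- The formula without square root holds only for `|z| ≤ s`, as `Real.sqrt` truncates; the strict
inequality makes it hold for all `s` near `t`. -/
theorem deriv_besselI0_mul_sqrt_sub (lam : ℝ) {t z : ℝ} (h : |z| < t) :
    deriv (fun s => besselI0 (lam * Real.sqrt (s ^ 2 - |z| ^ 2))) t =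
      lam ^ 2 * t / 2 * besselSeries 1 (lam ^ 2 * (t ^ 2 - z ^ 2) / 4) := by
  rw [← (hasDerivAt_besselSeries_time 0 lam z t).deriv]
  refine Filter.EventuallyEq.deriv_eq ?_
  filter_upwards [lt_mem_nhds h] with s hs using besselI0_mul_sqrt_sub lam hs.le

/-! ### The telegraph equations -/

section Equations

variable {c : ℝ → ℝ}

theorem continuous_travelTime (hint : ∀ x, IntervalIntegrable (fun w => 1 / c w) volume 0 x) :
    Continuous (travelTime c) :=
  intervalIntegral.continuous_primitive (fun a b => (hint a).symm.trans (hint b)) 0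

theorem hasDerivAt_travelTime (hc : Measurable c) (hpos : ∀ x, 0 < c x)
    (hint : ∀ x, IntervalIntegrable (fun w => 1 / c w) volume 0 x) {x : ℝ}
    (hx : ContinuousAt c x) : HasDerivAt (travelTime c) (1 / c x) x := by
  refine intervalIntegral.integral_hasDerivAt_right (hint x) ?_ ?_
  · exact (measurable_const.div hc).stronglyMeasurable.stronglyMeasurableAtFilter
  · exact continuousAt_const.div hx (hpos x).ne'

/-- A function of time and travel time that solves the telegraph equation with unit velocity gives
solutions of the telegraph equations with velocity `c`. -/
theorem solves_of_unit_velocity (hc : Measurable c) (hpos : ∀ x, 0 < c x)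
    (hint : ∀ x, IntervalIntegrable (fun w => 1 / c w) volume 0 x)
    {rate : ℝ → ℝ} {p : ℝ → ℝ → ℝ} {G Gt Gtt Gz Gzz : ℝ → ℝ → ℝ}
    (hG : ∀ w s, |travelTime c w| < s → c w * p w s = G (travelTime c w) s)
    (hGt : ∀ z s, 0 < s → HasDerivAt (G z) (Gt z s) s)
    (hGtt : ∀ z s, 0 < s → HasDerivAt (Gt z) (Gtt z s) s)
    (hGz : ∀ z s, 0 < s → HasDerivAt (fun y => G y s) (Gz z s) z)
    (hGzz : ∀ z s, 0 < s → HasDerivAt (fun y => Gz y s) (Gzz z s) z)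
    (heq : ∀ z s, |z| < s → Gtt z s + 2 * rate s * Gt z s = Gzz z s)
    {x t : ℝ} (ht : |travelTime c x| < t) (hx : ∀ᶠ z in 𝓝 x, ContinuousAt c z) :
    SolvesTelegraphAt rate c (fun x t => c x * p x t) x t ∧
      SolvesForwardTelegraphAt rate c p x t := by
  have ht0 : 0 < t := (abs_nonneg _).trans_lt ht
  have hcx := (hpos x).ne'
  have near_t : ∀ᶠ s in 𝓝 t, |travelTime c x| < s := lt_mem_nhds ht
  have near_x : ∀ᶠ z in 𝓝 x, |travelTime c z| < t :=
    (continuous_travelTime hint).abs.continuousAt.eventually_lt continuousAt_const ht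
  have dt : ∀ s, |travelTime c x| < s →
      HasDerivAt (fun r => c x * p x r) (Gt (travelTime c x) s) s := fun s hs =>
    (hGt _ s ((abs_nonneg _).trans_lt hs)).congr_of_eventuallyEq
      (by filter_upwards [lt_mem_nhds hs] with r hr using hG x r hr)
  have pt : ∀ s, |travelTime c x| < s →
      HasDerivAt (p x) ((c x)⁻¹ * Gt (travelTime c x) s) s := fun s hs => by
    have := (dt s hs).const_mul (c x)⁻¹
    refine this.congr_of_eventuallyEq (Eventually.of_forall fun r => ?_)
    simp only; field_simp
  have dtt : HasDerivAt (deriv fun r => c x * p x r) (Gtt (travelTime c x) t) t :=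
    (hGtt _ t ht0).congr_of_eventuallyEq
      (by filter_upwards [near_t] with s hs using (dt s hs).deriv)
  have ptt : HasDerivAt (deriv (p x)) ((c x)⁻¹ * Gtt (travelTime c x) t) t :=
    ((hGtt _ t ht0).const_mul _).congr_of_eventuallyEq
      (by filter_upwards [near_t] with s hs using (pt s hs).deriv)
  have dx : ∀ᶠ z in 𝓝 x, HasDerivAt (fun w => c w * p w t)
      (Gz (travelTime c z) t * (1 / c z)) z := by
    filter_upwards [near_x.eventually_nhds, hx] with z hz hcz
    refine ((hGz _ t ht0).comp z (hasDerivAt_travelTime hc hpos hint hcz)).congr_of_eventuallyEq ?_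
    filter_upwards [hz] with w hw using hG w t hw
  -- The outer factor `c` cancels the `1 / c` produced by the chain rule, so `c` itself is never
  -- differentiated and its continuity suffices.
  have dxx : HasDerivAt (fun z => c z * deriv (fun w => c w * p w t) z)
      (Gzz (travelTime c x) t * (1 / c x)) x := by
    refine ((hGzz _ t ht0).comp x
      (hasDerivAt_travelTime hc hpos hint hx.self_of_nhds)).congr_of_eventuallyEq ?_
    filter_upwards [dx] with z hz
    rw [hz.deriv]
    have := (hpos z).ne'
    simp only [Function.comp]; field_simp
  have h := heq _ t ht
  refine ⟨⟨near_t.mono fun s hs => (dt s hs).differentiableAt, dtt.differentiableAt,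
    dx.mono fun z hz => hz.differentiableAt, dxx.differentiableAt, ?_⟩,
    ⟨near_t.mono fun s hs => (pt s hs).differentiableAt, ptt.differentiableAt,
    dx.mono fun z hz => hz.differentiableAt, dxx.differentiableAt, ?_⟩⟩
  · rw [dtt.deriv, (dt t ht).deriv, dxx.deriv, h]
    field_simp
  · rw [ptt.deriv, (pt t ht).deriv, dxx.deriv, ← h]
    field_simp

theorem mul_tanhDensity (hpos : ∀ x, 0 < c x) (lam : ℝ) {x t : ℝ} (h : |travelTime c x| < t) :
    c x * tanhDensity lam c x t = lam ^ 2 * t / 4 *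
      besselSeries 1 (lam ^ 2 * (t ^ 2 - travelTime c x ^ 2) / 4) / Real.cosh (lam * t) := by
  have := (hpos x).ne'
  have := (Real.cosh_pos (lam * t)).ne'
  rw [tanhDensity, deriv_besselI0_mul_sqrt_sub lam h]
  field_simp
  ring

theorem mul_cothDensity (hpos : ∀ x, 0 < c x) (lam : ℝ) {x t : ℝ} (h : |travelTime c x| < t) :
    c x * cothDensity lam c x t = lam / 2 *
      besselSeries 0 (lam ^ 2 * (t ^ 2 - travelTime c x ^ 2) / 4) / Real.sinh (lam * t) := by
  have := (hpos x).ne'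
  rw [cothDensity, besselI0_mul_sqrt_sub lam h.le]
  field_simp

theorem hasDerivAt_cosh_mul (lam t : ℝ) :
    HasDerivAt (fun s => Real.cosh (lam * s)) (lam * Real.sinh (lam * t)) t := by
  simpa [mul_comm] using ((hasDerivAt_id t).const_mul lam).cosh

theorem hasDerivAt_sinh_mul (lam t : ℝ) :
    HasDerivAt (fun s => Real.sinh (lam * s)) (lam * Real.cosh (lam * t)) t := by
  simpa [mul_comm] using ((hasDerivAt_id t).const_mul lam).sinh

/-- If `g_tt - g_zz = λ² g` and `h'' = λ² h` then `u = g / h` solves the telegraph equation with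
rate `h' / h`. -/
theorem solves_of_quotient (hc : Measurable c) (hpos : ∀ x, 0 < c x)
    (hint : ∀ x, IntervalIntegrable (fun w => 1 / c w) volume 0 x)
    {lam : ℝ} {rate h h' : ℝ → ℝ} {p : ℝ → ℝ → ℝ} {g gt gtt gz gzz : ℝ → ℝ → ℝ}
    (hG : ∀ w s, |travelTime c w| < s → c w * p w s = g (travelTime c w) s / h s)
    (h0 : ∀ s, 0 < s → h s ≠ 0) (hh : ∀ s, HasDerivAt h (h' s) s)
    (hh' : ∀ s, HasDerivAt h' (lam ^ 2 * h s) s) (hrate : ∀ s, rate s = h' s / h s)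
    (hgt : ∀ z s, HasDerivAt (g z) (gt z s) s)
    (hgtt : ∀ z s, HasDerivAt (gt z) (gtt z s) s)
    (hgz : ∀ z s, HasDerivAt (fun y => g y s) (gz z s) z)
    (hgzz : ∀ z s, HasDerivAt (fun y => gz y s) (gzz z s) z)
    (heq : ∀ z s, gtt z s - gzz z s = lam ^ 2 * g z s)
    {x t : ℝ} (ht : |travelTime c x| < t) (hx : ∀ᶠ z in 𝓝 x, ContinuousAt c z) :
    SolvesTelegraphAt rate c (fun x t => c x * p x t) x t ∧
      SolvesForwardTelegraphAt rate c p x t := by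
  refine solves_of_unit_velocity hc hpos hint
    (G := fun z s => g z s / h s)
    (Gt := fun z s => (gt z s * h s - g z s * h' s) / h s ^ 2)
    (Gtt := fun z s => ((gtt z s * h s + gt z s * h' s - (gt z s * h' s + g z s * (lam ^ 2 * h s)))
      * h s ^ 2 - (gt z s * h s - g z s * h' s) * (2 * h s * h' s)) / (h s ^ 2) ^ 2)
    (Gz := fun z s => gz z s / h s) (Gzz := fun z s => gzz z s / h s)
    hG ?_ ?_ ?_ ?_ ?_ ht hx
  · exact fun z s hs => (hgt z s).div (hh s) (h0 s hs)
  · intro z s hs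
    have := (((hgtt z s).mul (hh s)).sub ((hgt z s).mul (hh' s))).div ((hh s).pow 2)
      (pow_ne_zero 2 (h0 s hs))
    simp only [Nat.cast_ofNat, Nat.add_one_sub_one, pow_one] at this
    exact this
  · exact fun z s _ => (hgz z s).div_const _
  · exact fun z s _ => (hgzz z s).div_const _
  · intro z s hs
    have := h0 s ((abs_nonneg _).trans_lt hs)
    have e := heq z s
    rw [hrate]
    field_simp
    linear_combination h s ^ 2 * e

/-- The numerators are `g = ½ ∂_t B` with `h = cosh λt` and `g = (λ / 2) B` with `h = sinh λt`,
where `B = besselSeries 0 (λ² (t² - z²) / 4)`. Bessel's equation makes `B`, and hence `∂_t B`, a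
solution of `g_tt - g_zz = λ² g`. -/
theorem telegraph_equations {lam : ℝ} (hlam : 0 < lam) (hc : Measurable c) (hpos : ∀ x, 0 < c x)
    (hint : ∀ x, IntervalIntegrable (fun w => 1 / c w) volume 0 x) {x t : ℝ}
    (ht : |travelTime c x| < t) (hx : ∀ᶠ z in 𝓝 x, ContinuousAt c z) :
    SolvesTelegraphAt (tanhRate lam) c (fun x t => c x * tanhDensity lam c x t) x t ∧
      SolvesForwardTelegraphAt (tanhRate lam) c (tanhDensity lam c) x t ∧
      SolvesTelegraphAt (cothRate lam) c (fun x t => c x * cothDensity lam c x t) x t ∧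
      SolvesForwardTelegraphAt (cothRate lam) c (cothDensity lam c) x t := by
  set B : ℕ → ℝ → ℝ → ℝ := fun m z s => besselSeries m (lam ^ 2 * (s ^ 2 - z ^ 2) / 4) with hB
  have Bt : ∀ m z s, HasDerivAt (B m z) (lam ^ 2 * s / 2 * B (m + 1) z s) s := fun m z s =>
    hasDerivAt_besselSeries_time m lam z s
  have Bz : ∀ m z s, HasDerivAt (fun y => B m y s) (-(lam ^ 2 * z / 2) * B (m + 1) z s) z :=
    fun m z s => hasDerivAt_besselSeries_space m lam z s
  have hrec : ∀ (m : ℕ) z s, lam ^ 2 * (s ^ 2 - z ^ 2) / 4 * B (m + 2) z s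
      + (m + 1) * B (m + 1) z s = B m z s := fun m z s => besselSeries_recurrence m _
  have lin2 : ∀ a s : ℝ, HasDerivAt (fun r => a * r / 2) (a / 2) s := fun a s => by
    simpa using ((hasDerivAt_id s).const_mul a).div_const 2
  have linn : ∀ a s : ℝ, HasDerivAt (fun r => -(a * r / 2)) (-(a / 2)) s := fun a s => (lin2 a s).neg
  have lin4 : ∀ a s : ℝ, HasDerivAt (fun r => a * r / 4) (a / 4) s := fun a s => by
    simpa using ((hasDerivAt_id s).const_mul a).div_const 4
  have key1 := solves_of_quotient hc hpos hint (lam := lam) (rate := tanhRate lam)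
    (h := fun s => Real.cosh (lam * s)) (h' := fun s => lam * Real.sinh (lam * s))
    (p := tanhDensity lam c)
    (g := fun z s => lam ^ 2 * s / 4 * B 1 z s)
    (gt := fun z s => lam ^ 2 / 4 * B 1 z s + lam ^ 2 * s / 4 * (lam ^ 2 * s / 2 * B 2 z s))
    (gtt := fun z s => lam ^ 2 / 4 * (lam ^ 2 * s / 2 * B 2 z s) +
      (lam ^ 2 / 4 * (lam ^ 2 * s / 2 * B 2 z s) + lam ^ 2 * s / 4 *
        (lam ^ 2 / 2 * B 2 z s + lam ^ 2 * s / 2 * (lam ^ 2 * s / 2 * B 3 z s))))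
    (gz := fun z s => lam ^ 2 * s / 4 * (-(lam ^ 2 * z / 2) * B 2 z s))
    (gzz := fun z s => lam ^ 2 * s / 4 * (-(lam ^ 2 / 2) * B 2 z s
      + -(lam ^ 2 * z / 2) * (-(lam ^ 2 * z / 2) * B 3 z s)))
    (fun w s hs => mul_tanhDensity hpos lam hs) (fun s _ => (Real.cosh_pos _).ne')
    (fun s => hasDerivAt_cosh_mul lam s)
    (fun s => by simpa [sq, mul_assoc] using (hasDerivAt_sinh_mul lam s).const_mul lam)
    (fun s => by rw [tanhRate, Real.tanh_eq_sinh_div_cosh, mul_div_assoc])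
    (fun z s => (lin4 _ s).mul (Bt 1 z s))
    (fun z s => ((Bt 1 z s).const_mul _).add ((lin4 _ s).mul ((lin2 _ s).mul (Bt 2 z s))))
    (fun z s => (Bz 1 z s).const_mul _)
    (fun z s => ((linn _ z).mul (Bz 2 z s)).const_mul _)
    (fun z s => by
      have h1 := hrec 1 z s
      norm_num at h1
      rw [← h1]; ring) ht hx
  have key2 := solves_of_quotient hc hpos hint (lam := lam) (rate := cothRate lam)
    (h := fun s => Real.sinh (lam * s)) (h' := fun s => lam * Real.cosh (lam * s))
    (p := cothDensity lam c)
    (g := fun z s => lam / 2 * B 0 z s)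
    (gt := fun z s => lam / 2 * (lam ^ 2 * s / 2 * B 1 z s))
    (gtt := fun z s => lam / 2 * (lam ^ 2 / 2 * B 1 z s + lam ^ 2 * s / 2 *
      (lam ^ 2 * s / 2 * B 2 z s)))
    (gz := fun z s => lam / 2 * (-(lam ^ 2 * z / 2) * B 1 z s))
    (gzz := fun z s => lam / 2 * (-(lam ^ 2 / 2) * B 1 z s
      + -(lam ^ 2 * z / 2) * (-(lam ^ 2 * z / 2) * B 2 z s)))
    (fun w s hs => mul_cothDensity hpos lam hs)
    (fun s hs => (Real.sinh_pos_iff.2 (mul_pos hlam hs)).ne')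
    (fun s => hasDerivAt_sinh_mul lam s)
    (fun s => by simpa [sq, mul_assoc] using (hasDerivAt_cosh_mul lam s).const_mul lam)
    (fun s => by rw [cothRate, mul_div_assoc])
    (fun z s => (Bt 0 z s).const_mul _)
    (fun z s => ((lin2 _ s).mul (Bt 1 z s)).const_mul _)
    (fun z s => (Bz 0 z s).const_mul _)
    (fun z s => ((linn _ z).mul (Bz 1 z s)).const_mul _)
    (fun z s => by
      have h1 := hrec 0 z s
      norm_num at h1
      rw [← h1]; ring) ht hx
  exact ⟨key1.1, key1.2, key2.1, key2.2⟩

end Equations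

/-! ### Exponential moments of the Bessel densities -/

/-- A beta integral in factorial form. Splitting off one factor `1 - y²` relates exponent `k + 1` at
`j` to exponent `k` at `j` and `j + 1`, which is why `j` stays universally quantified in the
induction on `k`. -/
theorem integral_even_pow_mul_one_sub_sq_pow (k : ℕ) : ∀ j : ℕ,
    (∫ y in (-1 : ℝ)..1, y ^ (2 * j) * (1 - y ^ 2) ^ k) =
      (2 : ℝ) * (2 * j).factorial * 4 ^ k * k.factorial * (j + k).factorial /
        (j.factorial * (2 * (j + k) + 1).factorial) := by
  induction k with
  | zero =>
    intro j
    simp only [pow_zero, mul_one, integral_pow, add_zero, Nat.factorial_zero, Nat.cast_one]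
    have h1 : ((2 * j + 1).factorial : ℝ) = (2 * j + 1) * (2 * j).factorial := by
      exact_mod_cast Nat.factorial_succ (2 * j)
    have : (j.factorial : ℝ) ≠ 0 := by positivity
    have : ((2 * j).factorial : ℝ) ≠ 0 := by positivity
    have : (2 * j + 1 : ℝ) ≠ 0 := by positivity
    rw [h1, Odd.neg_one_pow ⟨j, rfl⟩]
    push_cast
    field_simp
    norm_num
  | succ k ih =>
    intro j
    have hi : ∀ i, IntervalIntegrable (fun y : ℝ => y ^ (2 * i) * (1 - y ^ 2) ^ k) volume (-1) 1 :=
      fun i => (by fun_prop : Continuous _).intervalIntegrable _ _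
    have : ∀ y : ℝ, y ^ (2 * j) * (1 - y ^ 2) ^ (k + 1) =
        y ^ (2 * j) * (1 - y ^ 2) ^ k - y ^ (2 * (j + 1)) * (1 - y ^ 2) ^ k := fun y => by ring
    simp_rw [this]
    rw [intervalIntegral.integral_sub (hi j) (hi (j + 1)), ih j, ih (j + 1)]
    have e1 : j + 1 + k = (j + k) + 1 := by ring
    have e2 : j + (k + 1) = (j + k) + 1 := by ring
    have e3 : 2 * (j + k + 1) + 1 = (2 * (j + k) + 1) + 1 + 1 := by ring
    have e4 : 2 * (j + 1) = 2 * j + 1 + 1 := by ring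
    rw [e1, e2, e3, e4]
    simp only [Nat.factorial_succ]
    have : (j.factorial : ℝ) ≠ 0 := by positivity
    have : ((2 * (j + k)).factorial : ℝ) ≠ 0 := by positivity
    have : ((j : ℝ) + 1) ≠ 0 := by positivity
    have : (2 * ((j : ℝ) + k) + 1) ≠ 0 := by positivity
    have : (2 * ((j : ℝ) + k) + 1 + 1) ≠ 0 := by positivity
    have : (2 * ((j : ℝ) + k) + 1 + 1 + 1) ≠ 0 := by positivity
    push_cast
    field_simp
    ring

/-- Both factors are expanded and integrated term by term over pairs of indices. On `[-1, 1]` one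
has `|y| ≤ 1` and `|1 - y²| ≤ 1`, so the product of the two absolutely convergent series at `a` and
at `1` dominates. -/
theorem hasSum_integral_cosh_mul {d : ℕ → ℝ} (hd : Summable fun k => |d k|) (a : ℝ) :
    HasSum (fun p : ℕ × ℕ => a ^ (2 * p.1) * d p.2 *
      (2 * 4 ^ p.2 * p.2.factorial * (p.1 + p.2).factorial /
        (p.1.factorial * (2 * (p.1 + p.2) + 1).factorial)))
      (∫ y in (-1 : ℝ)..1, Real.cosh (a * y) * ∑' k, d k * (1 - y ^ 2) ^ k) := by
  have hcosh : Summable fun j : ℕ => |a| ^ (2 * j) / ((2 * j).factorial : ℝ) :=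
    (Real.hasSum_cosh |a|).summable
  have hb : Summable fun p : ℕ × ℕ => |a| ^ (2 * p.1) / ((2 * p.1).factorial : ℝ) * |d p.2| :=
    hcosh.mul_of_nonneg hd (fun j => by positivity) fun k => abs_nonneg _
  have hle : ∀ y ∈ Set.uIoc (-1 : ℝ) 1, |y| ≤ 1 ∧ |1 - y ^ 2| ≤ 1 := by
    intro y hy
    rw [Set.uIoc_of_le (by norm_num)] at hy
    refine ⟨abs_le.2 ⟨hy.1.le, hy.2⟩, abs_le.2 ⟨?_, ?_⟩⟩ <;> nlinarith [hy.1, hy.2]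
  have hbound : ∀ (p : ℕ × ℕ), ∀ y ∈ Set.uIoc (-1 : ℝ) 1,
      ‖(a * y) ^ (2 * p.1) / ((2 * p.1).factorial : ℝ) * (d p.2 * (1 - y ^ 2) ^ p.2)‖ ≤
        |a| ^ (2 * p.1) / ((2 * p.1).factorial : ℝ) * |d p.2| := by
    intro p y hy
    obtain ⟨h1, h2⟩ := hle y hy
    rw [norm_mul, norm_div, norm_pow, norm_mul, norm_mul, norm_pow]
    simp only [Real.norm_eq_abs, Nat.abs_cast]
    have h3 : |a| * |y| ≤ |a| := mul_le_of_le_one_right (abs_nonneg _) h1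
    have h4 : |d p.2| * |1 - y ^ 2| ^ p.2 ≤ |d p.2| :=
      mul_le_of_le_one_right (abs_nonneg _) (pow_le_one₀ (abs_nonneg _) h2)
    gcongr
  have key := intervalIntegral.hasSum_integral_of_dominated_convergence (a := -1) (b := 1)
    (μ := volume)
    (F := fun (p : ℕ × ℕ) (y : ℝ) =>
      (a * y) ^ (2 * p.1) / ((2 * p.1).factorial : ℝ) * (d p.2 * (1 - y ^ 2) ^ p.2))
    (f := fun y => Real.cosh (a * y) * ∑' k, d k * (1 - y ^ 2) ^ k)
    (fun p _ => |a| ^ (2 * p.1) / ((2 * p.1).factorial : ℝ) * |d p.2|)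
    (fun p => (by fun_prop : Continuous _).aestronglyMeasurable)
    (fun p => ae_of_all _ (hbound p)) (ae_of_all _ fun _ _ => hb) (by simp)
    (ae_of_all _ fun y hy => by
      have h2 : Summable fun k => d k * (1 - y ^ 2) ^ k := by
        refine Summable.of_norm_bounded hd fun k => ?_
        rw [norm_mul, norm_pow]
        exact mul_le_of_le_one_right (abs_nonneg _) (pow_le_one₀ (norm_nonneg _) (hle y hy).2)
      exact (Real.hasSum_cosh (a * y)).mul h2.hasSum
        (Summable.of_norm_bounded hb fun p => hbound p y hy))
  refine key.congr_fun fun p => ?_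
  have : ∀ y : ℝ, (a * y) ^ (2 * p.1) / ((2 * p.1).factorial : ℝ) * (d p.2 * (1 - y ^ 2) ^ p.2)
      = a ^ (2 * p.1) * d p.2 / ((2 * p.1).factorial : ℝ) *
        (y ^ (2 * p.1) * (1 - y ^ 2) ^ p.2) := fun y => by rw [mul_pow]; ring
  simp_rw [this]
  rw [intervalIntegral.integral_const_mul, integral_even_pow_mul_one_sub_sq_pow]
  have : ((2 * p.1).factorial : ℝ) ≠ 0 := by positivity
  field_simp

theorem hasSum_sum_antidiagonal {f : ℕ × ℕ → ℝ} {s : ℝ} (hf : HasSum f s) :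
    HasSum (fun n => ∑ p ∈ Finset.HasAntidiagonal.antidiagonal n, f p) s := by
  have h := (Finset.HasAntidiagonal.sigmaAntidiagonalEquivProd (A := ℕ)).hasSum_iff.2 hf
  refine h.sigma fun n => ?_
  have := hasSum_fintype fun p : Finset.HasAntidiagonal.antidiagonal n => f p
  rw [Finset.sum_coe_sort (Finset.HasAntidiagonal.antidiagonal n) f] at this
  exact this

theorem sum_antidiagonal_factorial_div (x y : ℝ) (n : ℕ) :
    ∑ p ∈ Finset.HasAntidiagonal.antidiagonal n, ((n.factorial : ℝ) / (p.1.factorial * p.2.factorial)) *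
      (x ^ p.1 * y ^ p.2) = (x + y) ^ n := by
  rw [(Commute.all x y).add_pow' n]
  refine Finset.sum_congr rfl fun p hp => ?_
  rw [Finset.HasAntidiagonal.mem_antidiagonal] at hp
  subst hp
  rw [nsmul_eq_mul, Nat.cast_add_choose]

theorem besselSeries_mul (m : ℕ) (r w : ℝ) : besselSeries m (r * w) =
    ∑' k : ℕ, r ^ k / ((k.factorial : ℝ) * ((k + m).factorial : ℝ)) * w ^ k :=
  tsum_congr fun k => by rw [mul_pow]; ring

theorem summable_abs_besselSeries (m : ℕ) (w : ℝ) :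
    Summable fun k : ℕ => |w ^ k / ((k.factorial : ℝ) * ((k + m).factorial : ℝ))| :=
  (summable_besselSeries m w).abs

/-- On the antidiagonal `j + k = n` the beta integral cancels the power of `4` and leaves binomial
coefficients, so level `n` sums to `2 (a² + b²)^n / (2n + 1)!`. With the root as a factor on the
left, its vanishing needs no separate case. -/
theorem integral_cosh_mul_besselSeries_zero (a b : ℝ) :
    Real.sqrt (a ^ 2 + b ^ 2) *
      ∫ y in (-1 : ℝ)..1, Real.cosh (a * y) * besselSeries 0 (b ^ 2 / 4 * (1 - y ^ 2)) =
      2 * Real.sinh (Real.sqrt (a ^ 2 + b ^ 2)) := by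
  set q := Real.sqrt (a ^ 2 + b ^ 2) with hq
  have hq2 : q ^ 2 = a ^ 2 + b ^ 2 := Real.sq_sqrt (by positivity)
  simp_rw [besselSeries_mul]
  have h1 := (hasSum_sum_antidiagonal
    (hasSum_integral_cosh_mul (summable_abs_besselSeries 0 (b ^ 2 / 4)) a)).mul_left q
  have h2 := (Real.hasSum_sinh q).mul_left 2
  refine h1.unique (h2.congr_fun fun n => ?_)
  rw [pow_succ q, pow_mul q, hq2, ← sum_antidiagonal_factorial_div, Finset.sum_mul, Finset.sum_div,
    Finset.mul_sum, Finset.mul_sum]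
  refine Finset.sum_congr rfl fun p hp => ?_
  rw [Finset.HasAntidiagonal.mem_antidiagonal] at hp
  rw [hp, pow_mul, div_pow, add_zero]
  have : (p.1.factorial : ℝ) ≠ 0 := by positivity
  have : (p.2.factorial : ℝ) ≠ 0 := by positivity
  have : ((2 * n + 1).factorial : ℝ) ≠ 0 := by positivity
  field_simp

/-- The factor `(k + 1)!` in the order-one series makes level `n` the binomial expansion of `(a² +
b²)^(n + 1)` without its pure power of `a`. The missing powers add up to the subtracted `cosh a`,
the contribution that the atoms will supply. -/
theorem integral_cosh_mul_besselSeries_one (a b : ℝ) :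
    ∫ y in (-1 : ℝ)..1, Real.cosh (a * y) * (b ^ 2 / 2 *
      besselSeries 1 (b ^ 2 / 4 * (1 - y ^ 2))) =
      2 * Real.cosh (Real.sqrt (a ^ 2 + b ^ 2)) - 2 * Real.cosh a := by
  set q := Real.sqrt (a ^ 2 + b ^ 2) with hq
  have hq2 : q ^ 2 = a ^ 2 + b ^ 2 := Real.sq_sqrt (by positivity)
  simp_rw [besselSeries_mul, mul_left_comm _ (b ^ 2 / 2)]
  rw [intervalIntegral.integral_const_mul]
  have h1 := (hasSum_sum_antidiagonal
    (hasSum_integral_cosh_mul (summable_abs_besselSeries 1 (b ^ 2 / 4)) a)).mul_left (b ^ 2 / 2)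
  have h2 := (((Real.hasSum_cosh q).mul_left 2).sub ((Real.hasSum_cosh a).mul_left 2))
  rw [← hasSum_nat_add_iff' 1] at h2
  simp only [Finset.range_one, Finset.sum_singleton, mul_zero, pow_zero, sub_self, sub_zero] at h2
  refine h1.unique (h2.congr_fun fun n => ?_)
  have e1 : q ^ (2 * (n + 1)) = a ^ (2 * (n + 1)) + ∑ p ∈ Finset.HasAntidiagonal.antidiagonal n,
      (((n + 1).factorial : ℝ) / (p.1.factorial * (p.2 + 1).factorial)) *
        ((a ^ 2) ^ p.1 * (b ^ 2) ^ (p.2 + 1)) := by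
    rw [pow_mul, hq2, ← sum_antidiagonal_factorial_div, Finset.Nat.sum_antidiagonal_succ']
    congr 1
    have : ((n + 1).factorial : ℝ) ≠ 0 := by positivity
    simp [pow_mul, this]
  rw [e1]
  have e2 : ∀ A B F : ℝ, 2 * ((A + B) / F) - 2 * (A / F) = 2 / F * B := fun A B F => by ring
  rw [e2, Finset.mul_sum, Finset.mul_sum]
  refine Finset.sum_congr rfl fun p hp => ?_
  rw [Finset.HasAntidiagonal.mem_antidiagonal] at hp
  rw [hp, pow_mul, div_pow, show 2 * (n + 1) = 2 * n + 1 + 1 by ring,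
    Nat.factorial_succ (2 * n + 1), Nat.factorial_succ n]
  have : (p.1.factorial : ℝ) ≠ 0 := by positivity
  have : (p.2.factorial : ℝ) ≠ 0 := by positivity
  have : ((p.2 + 1).factorial : ℝ) ≠ 0 := by positivity
  have : ((2 * n + 1).factorial : ℝ) ≠ 0 := by positivity
  have : ((2 * n + 1 + 1 : ℕ) : ℝ) ≠ 0 := by positivity
  push_cast at this ⊢
  field_simp
  ring

theorem integral_exp_mul_even {t : ℝ} (u : ℝ) {f : ℝ → ℝ} (hf : Continuous f)
    (heven : ∀ z, f (-z) = f z) :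
    ∫ z in -t..t, Real.exp (u * z) * f z =
      t * ∫ y in (-1 : ℝ)..1, Real.cosh (u * t * y) * f (t * y) := by
  have h1 : ∫ z in -t..t, Real.exp (u * z) * f z = ∫ z in -t..t, Real.exp (-(u * z)) * f z := by
    have := intervalIntegral.integral_comp_neg (a := -t) (b := t)
      (fun z => Real.exp (u * z) * f z)
    simp only [neg_neg, heven, mul_neg] at this
    exact this.symm
  have h2 : ∫ z in -t..t, Real.exp (u * z) * f z = ∫ z in -t..t, Real.cosh (u * z) * f z := by
    have e : ∀ z, Real.cosh (u * z) * f z =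
        (Real.exp (u * z) * f z + Real.exp (-(u * z)) * f z) / 2 := fun z => by
      rw [Real.cosh_eq]; ring
    simp_rw [e]
    rw [intervalIntegral.integral_div, intervalIntegral.integral_add, ← h1]
    · ring
    · exact (by fun_prop : Continuous _).intervalIntegrable _ _
    · exact (by fun_prop : Continuous _).intervalIntegrable _ _
  rw [h2]
  have h3 := intervalIntegral.smul_integral_comp_mul_left (a := -1) (b := 1)
    (fun z => Real.cosh (u * z) * f z) t
  simp only [smul_eq_mul, mul_neg, mul_one] at h3
  rw [← h3]
  simp only [mul_assoc]

theorem integral_exp_mul_besselSeries_zero {lam t : ℝ} (ht : 0 ≤ t) (u : ℝ) :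
    Real.sqrt (u ^ 2 + lam ^ 2) *
      ∫ z in -t..t, Real.exp (u * z) * besselSeries 0 (lam ^ 2 * (t ^ 2 - z ^ 2) / 4) =
      2 * Real.sinh (Real.sqrt (u ^ 2 + lam ^ 2) * t) := by
  have hcont := continuous_besselSeries 0
  rw [integral_exp_mul_even u (f := fun z => besselSeries 0 (lam ^ 2 * (t ^ 2 - z ^ 2) / 4))
    (by fun_prop) (fun z => by simp)]
  have h := integral_cosh_mul_besselSeries_zero (u * t) (lam * t)
  have e : Real.sqrt ((u * t) ^ 2 + (lam * t) ^ 2) = Real.sqrt (u ^ 2 + lam ^ 2) * t := by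
    rw [mul_pow, mul_pow, ← add_mul, Real.sqrt_mul (by positivity), Real.sqrt_sq ht]
  rw [e] at h
  rw [← h, ← mul_assoc]
  congr 2
  funext y
  congr 2
  ring

theorem integral_exp_mul_besselSeries_one {lam t : ℝ} (ht : 0 ≤ t) (u : ℝ) :
    ∫ z in -t..t, Real.exp (u * z) *
      (lam ^ 2 * t / 2 * besselSeries 1 (lam ^ 2 * (t ^ 2 - z ^ 2) / 4)) =
      2 * Real.cosh (Real.sqrt (u ^ 2 + lam ^ 2) * t) - 2 * Real.cosh (u * t) := by
  have hcont := continuous_besselSeries 1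
  rw [integral_exp_mul_even u
    (f := fun z => lam ^ 2 * t / 2 * besselSeries 1 (lam ^ 2 * (t ^ 2 - z ^ 2) / 4))
    (by fun_prop) (fun z => by simp)]
  have h := integral_cosh_mul_besselSeries_one (u * t) (lam * t)
  have e : Real.sqrt ((u * t) ^ 2 + (lam * t) ^ 2) = Real.sqrt (u ^ 2 + lam ^ 2) * t := by
    rw [mul_pow, mul_pow, ← add_mul, Real.sqrt_mul (by positivity), Real.sqrt_sq ht]
  rw [e] at h
  rw [← h, ← intervalIntegral.integral_const_mul]
  congr 1
  funext y
  rw [show lam ^ 2 * (t ^ 2 - (t * y) ^ 2) / 4 = (lam * t) ^ 2 / 4 * (1 - y ^ 2) by ring]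
  ring

/-! ### Change of variables along a path of measurable speed -/

section

section Primitive

variable {a b : ℝ} {g x : ℝ → ℝ}

theorem continuousOn_of_primitive (hab : a ≤ b) (hgi : IntervalIntegrable g volume a b)
    (hx : ∀ s ∈ Set.Icc a b, x s = x a + ∫ r in a..s, g r) : ContinuousOn x (Set.Icc a b) := by
  have h := intervalIntegral.continuousOn_primitive_interval' hgi (Set.left_mem_uIcc)
  rw [Set.uIcc_of_le hab] at h
  exact (continuousOn_const.add h).congr hx

theorem strictMonoOn_of_primitive (hg : ∀ s, 0 < g s) (hgi : IntervalIntegrable g volume a b)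
    (hx : ∀ s ∈ Set.Icc a b, x s = x a + ∫ r in a..s, g r) : StrictMonoOn x (Set.Icc a b) := by
  intro s hs s' hs' hss
  have h1 : IntervalIntegrable g volume a s :=
    hgi.mono_set (Set.uIcc_subset_uIcc_left (Set.Icc_subset_uIcc hs))
  have h2 : IntervalIntegrable g volume a s' :=
    hgi.mono_set (Set.uIcc_subset_uIcc_left (Set.Icc_subset_uIcc hs'))
  have := intervalIntegral.intervalIntegral_pos_of_pos_on (h1.symm.trans h2) (fun r _ => hg r) hss
  rw [← intervalIntegral.integral_interval_sub_left h2 h1] at this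
  rw [hx s hs, hx s' hs']
  linarith

/-- A primitive `x` of a positive function `g` transports the measure `g(s) ds` to Lebesgue
measure. -/
theorem map_withDensity_of_primitive (hab : a ≤ b) (hg : ∀ s, 0 < g s)
    (hgi : IntervalIntegrable g volume a b)
    (hx : ∀ s ∈ Set.Icc a b, x s = x a + ∫ r in a..s, g r) :
    ((volume.restrict (Set.Ioc a b)).withDensity fun s => ENNReal.ofReal (g s)).map x =
      volume.restrict (Set.Ioc (x a) (x b)) := by
  have hcont := continuousOn_of_primitive hab hgi hx
  have hmono := strictMonoOn_of_primitive hg hgi hx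
  have ha : a ∈ Set.Icc a b := ⟨le_rfl, hab⟩
  have hb : b ∈ Set.Icc a b := ⟨hab, le_rfl⟩
  have hgon : IntegrableOn g (Set.Ioc a b) := hgi.1
  have hmeas : AEMeasurable x ((volume.restrict (Set.Ioc a b)).withDensity
      fun s => ENNReal.ofReal (g s)) :=
    ((hcont.aemeasurable measurableSet_Icc).mono_measure
      (Measure.restrict_mono Set.Ioc_subset_Icc_self le_rfl)).mono_ac
      (withDensity_absolutelyContinuous _ _)
  have hfin : IsFiniteMeasure ((volume.restrict (Set.Ioc a b)).withDensity
      fun s => ENNReal.ofReal (g s)) :=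
    isFiniteMeasure_withDensity_ofReal hgon.2
  refine Measure.ext_of_Iic _ _ fun y => ?_
  -- Clamping `y` to `[x a, x b]` gives a value that the path attains. The preimage of `Iic y` is
  -- then `Ioc a s` in every case, including `y` outside the range of the path.
  obtain ⟨s, hs, hsy⟩ : ∃ s ∈ Set.Icc a b, x s = max (x a) (min y (x b)) := by
    have := intermediate_value_Icc hab hcont
    exact this ⟨le_max_left _ _, max_le (hmono.monotoneOn ha hb hab) (min_le_right _ _)⟩
  have hset : x ⁻¹' Set.Iic y ∩ Set.Ioc a b = Set.Ioc a s := by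
    ext r
    simp only [Set.mem_inter_iff, Set.mem_preimage, Set.mem_Iic, Set.mem_Ioc]
    constructor
    · rintro ⟨hry, hr⟩
      refine ⟨hr.1, ?_⟩
      rw [← hmono.le_iff_le ⟨hr.1.le, hr.2⟩ hs, hsy]
      exact le_max_of_le_right (le_min hry (hmono.monotoneOn ⟨hr.1.le, hr.2⟩ hb hr.2))
    · rintro ⟨har, hrs⟩
      have hr : r ∈ Set.Icc a b := ⟨har.le, hrs.trans hs.2⟩
      refine ⟨?_, har, hr.2⟩
      have h1 := hmono.monotoneOn hr hs hrs
      have h2 := hmono ha hr har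
      rw [hsy] at h1
      rcases le_max_iff.1 h1 with h | h
      · exact absurd h (not_le.2 h2)
      · exact h.trans (min_le_left _ _)
  rw [Measure.map_apply_of_aemeasurable hmeas measurableSet_Iic,
    Measure.restrict_apply measurableSet_Iic, ← withDensity_indicator measurableSet_Ioc,
    withDensity_apply' , lintegral_indicator measurableSet_Ioc,
    Measure.restrict_restrict measurableSet_Ioc, Set.inter_comm, hset]
  have hgs : IntegrableOn g (Set.Ioc a s) := hgon.mono_set (Set.Ioc_subset_Ioc_right hs.2)
  rw [← ofReal_integral_eq_lintegral_ofReal hgs (ae_of_all _ fun r => (hg r).le),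
    ← intervalIntegral.integral_of_le hs.1]
  have : ∫ r in a..s, g r = x s - x a := by rw [hx s hs]; ring
  rw [this]
  have hset' : Set.Iic y ∩ Set.Ioc (x a) (x b) = Set.Ioc (x a) (min y (x b)) := by
    ext r; simp only [Set.mem_inter_iff, Set.mem_Iic, Set.mem_Ioc, le_min_iff]; tauto
  rw [hset', Real.volume_Ioc, hsy]
  rcases le_total (x a) (min y (x b)) with h | h
  · rw [max_eq_right h]
  · rw [max_eq_left h, sub_self, ENNReal.ofReal_zero, ENNReal.ofReal_of_nonpos (by linarith)]

end Primitive

variable {c : ℝ → ℝ}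

/-- Lebesgue measure on `(x a, x b]` is the image of `c(x(s)) ds`, against which `1 / c` integrates
to `∫ 1 ds`. This replaces the pointwise chain rule, which is unavailable for measurable `c`; lower
integrals avoid presupposing that `1 / c` is integrable. -/
theorem integral_one_div_of_primitive (hc : Measurable c) (hpos : ∀ w, 0 < c w) {a b : ℝ}
    {x : ℝ → ℝ} (hab : a ≤ b) (hgi : IntervalIntegrable (fun s => c (x s)) volume a b)
    (hx : ∀ s ∈ Set.Icc a b, x s = x a + ∫ r in a..s, c (x r)) :
    ∫ w in x a..x b, 1 / c w = b - a := by
  have hg : ∀ s, 0 < c (x s) := fun s => hpos _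
  have hcont := continuousOn_of_primitive hab hgi hx
  have hle : x a ≤ x b := (strictMonoOn_of_primitive hg hgi hx).monotoneOn
    ⟨le_rfl, hab⟩ ⟨hab, le_rfl⟩ hab
  have hxm : AEMeasurable x (volume.restrict (Set.Ioc a b)) :=
    (hcont.aemeasurable measurableSet_Icc).mono_measure
      (Measure.restrict_mono Set.Ioc_subset_Icc_self le_rfl)
  have hcm : Measurable fun w => ENNReal.ofReal (1 / c w) := by fun_prop
  have hm1 : AEMeasurable (fun s => ENNReal.ofReal (c (x s))) (volume.restrict (Set.Ioc a b)) :=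
    (hc.comp_aemeasurable hxm).ennreal_ofReal
  have hm2 : AEMeasurable (fun s => ENNReal.ofReal (1 / c (x s)))
      (volume.restrict (Set.Ioc a b)) := hcm.comp_aemeasurable hxm
  rw [intervalIntegral.integral_of_le hle, integral_eq_lintegral_of_nonneg_ae
    (ae_of_all _ fun w => (one_div_pos.2 (hpos w)).le)
    (measurable_const.div hc).aestronglyMeasurable,
    ← map_withDensity_of_primitive hab hg hgi hx, lintegral_map' hcm.aemeasurable
      (hxm.mono_ac (withDensity_absolutelyContinuous _ _)),
    lintegral_withDensity_eq_lintegral_mul₀ hm1 hm2]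
  have : ∀ s, ((fun s => ENNReal.ofReal (c (x s))) * fun s => ENNReal.ofReal (1 / c (x s))) s
      = 1 := fun s => by
    rw [Pi.mul_apply, ← ENNReal.ofReal_mul (hpos _).le, mul_one_div_cancel (hpos _).ne',
      ENNReal.ofReal_one]
  simp_rw [this]
  simp [hab]

theorem travelTime_sub (hint : ∀ x, IntervalIntegrable (fun w => 1 / c w) volume 0 x) (x y : ℝ) :
    travelTime c y - travelTime c x = ∫ w in x..y, 1 / c w :=
  intervalIntegral.integral_interval_sub_left (hint y) (hint x)

/-- While the direction is constant the travel time changes at unit speed. -/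
theorem travelTime_sub_of_const_direction (hc : Measurable c) (hpos : ∀ w, 0 < c w)
    (hint : ∀ x, IntervalIntegrable (fun w => 1 / c w) volume 0 x) {a b v : ℝ} {x : ℝ → ℝ}
    (hv : v = 1 ∨ v = -1) (hab : a ≤ b)
    (hgi : IntervalIntegrable (fun s => v * c (x s)) volume a b)
    (hx : ∀ s ∈ Set.Icc a b, x s = x a + ∫ r in a..s, v * c (x r)) :
    travelTime c (x b) - travelTime c (x a) = v * (b - a) := by
  rw [travelTime_sub hint]
  rcases hv with rfl | rfl
  · simp only [one_mul] at hgi hx ⊢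
    exact integral_one_div_of_primitive hc hpos hab hgi hx
  · simp only [neg_mul, one_mul, intervalIntegral.integral_neg] at hgi hx ⊢
    have hgi' : IntervalIntegrable (fun s => c (x s)) volume a b := by
      simpa [Pi.neg_def] using hgi.neg
    -- Backward motion is the reflection of a forward motion `-x` in the reflected speed `w ↦ c
    -- (-w)`.
    have := integral_one_div_of_primitive (c := fun w => c (-w)) (x := fun s => -x s)
      (hc.comp measurable_neg) (fun w => hpos _) hab (by simpa using hgi')
      (fun s hs => by simp only [neg_neg]; rw [hx s hs]; ring)
    rw [intervalIntegral.integral_comp_neg (fun w => 1 / c w), neg_neg, neg_neg,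
      intervalIntegral.integral_symm] at this
    linarith

/-! ### Discretisation of time from the right -/

/-- The smallest multiple of `1 / (n + 1)` greater than `s`. -/
def gridPoint (n : ℕ) (s : ℝ) : ℝ := (⌊((n : ℝ) + 1) * s⌋ + 1) / ((n : ℝ) + 1)

theorem lt_gridPoint (n : ℕ) (s : ℝ) : s < gridPoint n s := by
  have h : (0 : ℝ) < (n : ℝ) + 1 := by positivity
  rw [gridPoint, lt_div_iff₀ h, mul_comm]
  exact Int.lt_floor_add_one _

theorem gridPoint_le (n : ℕ) (s : ℝ) : gridPoint n s ≤ s + 1 / ((n : ℝ) + 1) := by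
  have h : (0 : ℝ) < (n : ℝ) + 1 := by positivity
  rw [gridPoint, div_le_iff₀ h, add_mul s, one_div_mul_cancel h.ne', mul_comm s]
  linarith [Int.floor_le (((n : ℝ) + 1) * s)]

theorem tendsto_gridPoint (s : ℝ) : Tendsto (fun n => gridPoint n s) atTop (𝓝[>] s) := by
  refine tendsto_nhdsWithin_iff.2 ⟨?_, Eventually.of_forall fun n => lt_gridPoint n s⟩
  have h : Tendsto (fun n : ℕ => s + 1 / ((n : ℝ) + 1)) atTop (𝓝 s) := by
    simpa using tendsto_const_nhds.add (tendsto_one_div_add_atTop_nhds_zero_nat (𝕜 := ℝ))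
  exact tendsto_of_tendsto_of_tendsto_of_le_of_le tendsto_const_nhds h
    (fun n => (lt_gridPoint n s).le) (fun n => gridPoint_le n s)

/-- A process with measurable marginals and right-continuous paths is jointly measurable. -/
theorem aestronglyMeasurable_of_right_continuous {Ω : Type*} [MeasurableSpace Ω] {P : Measure Ω}
    [SFinite P] {F : ℝ → Ω → ℝ} (hF : ∀ s, Measurable (F s)) {D : Set ℝ} (hD : MeasurableSet D)
    (hright : ∀ᵐ ω ∂P, ∀ s ∈ D, Tendsto (fun r => F r ω) (𝓝[>] s) (𝓝 (F s ω))) :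
    AEStronglyMeasurable (Function.uncurry F) ((volume.restrict D).prod P) := by
  refine aestronglyMeasurable_of_tendsto_ae atTop
    (f := fun (n : ℕ) (q : ℝ × Ω) => F (gridPoint n q.1) q.2) (fun n => ?_) ?_
  -- The discretised process involves only countably many times, so measurability of the marginals
  -- gives joint measurability.
  · have h1 : Measurable fun q : ℤ × Ω => F (((q.1 : ℝ) + 1) / ((n : ℝ) + 1)) q.2 :=
      measurable_from_prod_countable_right fun k => hF (((k : ℝ) + 1) / ((n : ℝ) + 1))
    have h2 : Measurable fun q : ℝ × Ω => ((⌊((n : ℝ) + 1) * q.1⌋ : ℤ), q.2) := by fun_prop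
    exact (h1.comp h2).aestronglyMeasurable
  · have h1 : ∀ᵐ q ∂((volume.restrict D).prod P), q.1 ∈ D :=
      Measure.quasiMeasurePreserving_fst.ae (ae_restrict_mem hD)
    have h2 := Measure.quasiMeasurePreserving_snd (μ := volume.restrict D) |>.ae hright
    filter_upwards [h1, h2] with q hq1 hq2
    exact (hq2 q.1 hq1).comp (tendsto_gridPoint q.1)

/-! ### Direction paths and the travel time of the particle -/

/-- A path of the direction process: values `±1`, reversed at the points of `S`, which accumulate
at most at time `0`. -/
structure IsDirectionPath (S : Set ℝ) (V : ℝ → ℝ) : Prop where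
  finite : ∀ a b : ℝ, 0 < a → (S ∩ Set.Ioc a b).Finite
  sign : ∀ s, 0 < s → V s = 1 ∨ V s = -1
  reversal : ∀ s t, 0 < s → s ≤ t → V t = V s * (-1) ^ (S ∩ Set.Ioc s t).ncard

/-- A set that is finite to the right of `s` has no point immediately after `s`. -/
theorem eventually_inter_Ioc_eq_empty {S : Set ℝ} {s : ℝ} {b : ℝ} (hb : s < b)
    (hfin : (S ∩ Set.Ioc s b).Finite) : ∀ᶠ r in 𝓝[≥] s, S ∩ Set.Ioc s r = ∅ := by
  have h1 : ∀ᶠ r in 𝓝 s, ∀ p ∈ S ∩ Set.Ioc s b, r < p :=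
    (eventually_all_finite hfin).2 fun p hp => gt_mem_nhds hp.2.1
  filter_upwards [nhdsWithin_le_nhds h1, nhdsWithin_le_nhds (gt_mem_nhds hb)] with r hr hrb
  refine Set.eq_empty_of_forall_notMem fun p hp => ?_
  exact absurd hp.2.2 (not_le.2 (hr p ⟨hp.1, hp.2.1, hp.2.2.trans hrb.le⟩))

namespace IsDirectionPath

variable {S : Set ℝ} {V : ℝ → ℝ}

theorem eventually_eq (h : IsDirectionPath S V) {s : ℝ} (hs : 0 < s) :
    ∀ᶠ r in 𝓝[≥] s, V r = V s := by
  filter_upwards [eventually_inter_Ioc_eq_empty (lt_add_one s) (h.finite s (s + 1) hs),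
    self_mem_nhdsWithin] with r hr hsr
  rw [h.reversal s r hs hsr, hr, Set.ncard_empty, pow_zero, mul_one]

theorem tendsto_right (h : IsDirectionPath S V) {s : ℝ} (hs : 0 < s) :
    Tendsto V (𝓝[>] s) (𝓝 (V s)) :=
  tendsto_const_nhds.congr' (((h.eventually_eq hs).filter_mono
    (nhdsWithin_mono s Set.Ioi_subset_Ici_self)).mono fun _ hr => hr.symm)

theorem abs_eq_one (h : IsDirectionPath S V) {s : ℝ} (hs : 0 < s) : |V s| = 1 := by
  rcases h.sign s hs with h | h <;> simp [h]

theorem aestronglyMeasurable (h : IsDirectionPath S V) :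
    AEStronglyMeasurable V (volume.restrict (Set.Ioi 0)) := by
  refine aestronglyMeasurable_of_tendsto_ae atTop
    (f := fun (n : ℕ) (s : ℝ) => V (gridPoint n s)) (fun n => ?_) ?_
  · have h1 : Measurable fun k : ℤ => V (((k : ℝ) + 1) / ((n : ℝ) + 1)) := measurable_of_countable _
    have h2 : Measurable fun s : ℝ => (⌊((n : ℝ) + 1) * s⌋ : ℤ) := by fun_prop
    exact (h1.comp h2).aestronglyMeasurable
  · filter_upwards [ae_restrict_mem measurableSet_Ioi] with s hs
    exact (h.tendsto_right hs).comp (tendsto_gridPoint s)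

theorem intervalIntegrable (h : IsDirectionPath S V) {a b : ℝ} (ha : 0 ≤ a) (hb : 0 ≤ b) :
    IntervalIntegrable V volume a b := by
  have hsub : Set.uIoc a b ⊆ Set.Ioi 0 := fun s hs => (le_min ha hb).trans_lt hs.1
  rw [intervalIntegrable_iff]
  have : IsFiniteMeasure (volume.restrict (Set.uIoc a b)) :=
    ⟨by simp [Set.uIoc]⟩
  refine Integrable.of_bound (h.aestronglyMeasurable.mono_measure
    (Measure.restrict_mono hsub le_rfl)) 1 ?_
  filter_upwards [ae_restrict_mem measurableSet_uIoc] with s hs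
  exact (h.abs_eq_one (hsub hs)).le

/-- The travel time of the position is the integral of the direction. -/
theorem travelTime_eq (h : IsDirectionPath S V) (hc : Measurable c) (hpos : ∀ w, 0 < c w)
    (hint : ∀ x, IntervalIntegrable (fun w => 1 / c w) volume 0 x) {T : ℝ} {x : ℝ → ℝ}
    (hmotion : ∀ t ∈ Set.Icc 0 T, IntervalIntegrable (fun s => V s * c (x s)) volume 0 t ∧
      x t = ∫ s in (0 : ℝ)..t, V s * c (x s)) :
    ∀ t ∈ Set.Icc 0 T, travelTime c (x t) = ∫ s in (0 : ℝ)..t, V s := by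
  intro t ht
  have hx0 : x 0 = 0 := by
    simpa using (hmotion 0 ⟨le_rfl, ht.1.trans ht.2⟩).2
  rcases ht.1.eq_or_lt with rfl | ht0
  · simp [hx0, travelTime]
  have hxc : ContinuousOn x (Set.Icc 0 t) :=
    continuousOn_of_primitive ht.1 (hmotion t ht).1 fun s hs => by
      rw [hx0, zero_add]; exact (hmotion s ⟨hs.1, hs.2.trans ht.2⟩).2
  have hVc : ContinuousOn (fun r => ∫ s in (0 : ℝ)..r, V s) (Set.Icc 0 t) := by
    have := intervalIntegral.continuousOn_primitive_interval'
      (h.intervalIntegrable le_rfl ht.1) Set.left_mem_uIcc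
    rwa [Set.uIcc_of_le ht.1] at this
  -- The difference is continuous on `[0, t]` and constant just after each positive time, because no
  -- reversal follows immediately. Its right derivative therefore vanishes and it is constant on
  -- `[a, t]` for each `a > 0`; continuity at `0` finishes, even if reversals accumulate there.
  set φ : ℝ → ℝ := fun r => travelTime c (x r) - ∫ s in (0 : ℝ)..r, V s with hφ
  have hφc : ContinuousOn φ (Set.Icc 0 t) :=
    ((continuous_travelTime hint).comp_continuousOn hxc).sub hVc
  have hconst : ∀ a, 0 < a → a ≤ t → φ t = φ a := by
    intro a ha hat
    refine constant_of_has_deriv_right_zero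
      (hφc.mono (Set.Icc_subset_Icc_left ha.le)) (fun s hs => ?_) t ⟨hat, le_rfl⟩
    have hs0 : 0 < s := ha.trans_le hs.1
    have hloc : ∀ᶠ r in 𝓝[≥] s, φ r = φ s := by
      obtain ⟨b, hb, hVb⟩ := mem_nhdsGE_iff_exists_Ico_subset.1 (h.eventually_eq hs0)
      filter_upwards [self_mem_nhdsWithin, nhdsWithin_le_nhds (gt_mem_nhds hb),
        nhdsWithin_le_nhds (gt_mem_nhds hs.2)] with r (hsr : s ≤ r) hrb hrt
      have hVc' : ∀ q ∈ Set.Icc s r, V q = V s := fun q hq => hVb ⟨hq.1, hq.2.trans_lt hrb⟩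
      have hsT : s ∈ Set.Icc 0 T := ⟨hs0.le, hs.2.le.trans ht.2⟩
      have hrT : r ∈ Set.Icc 0 T := ⟨hs0.le.trans hsr, hrt.le.trans ht.2⟩
      have key := travelTime_sub_of_const_direction hc hpos hint (h.sign s hs0) hsr
        (x := x) (((hmotion s hsT).1.symm.trans (hmotion r hrT).1).congr fun q hq => by
          rw [Set.uIoc_of_le hsr] at hq
          simp only [hVc' q ⟨hq.1.le, hq.2⟩])
        (fun q hq => by
          have hqT : q ∈ Set.Icc 0 T := ⟨hs0.le.trans hq.1, hq.2.trans hrT.2⟩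
          rw [intervalIntegral.integral_congr (g := fun r => V r * c (x r)) fun y hy => by
            rw [Set.uIcc_of_le hq.1] at hy
            simp only [hVc' y ⟨hy.1, hy.2.trans hq.2⟩]]
          rw [← intervalIntegral.integral_interval_sub_left (hmotion q hqT).1 (hmotion s hsT).1,
            ← (hmotion q hqT).2, ← (hmotion s hsT).2]
          ring)
      have key2 : (∫ q in (0 : ℝ)..r, V q) - ∫ q in (0 : ℝ)..s, V q = V s * (r - s) := by
        rw [intervalIntegral.integral_interval_sub_left
          (h.intervalIntegrable le_rfl hrT.1) (h.intervalIntegrable le_rfl hs0.le),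
          intervalIntegral.integral_congr (g := fun _ => V s) fun y hy => by
            rw [Set.uIcc_of_le hsr] at hy
            exact hVc' y hy]
        simp [mul_comm]
      simp only [hφ]
      linarith
    exact (hasDerivWithinAt_const s _ (φ s)).congr_of_eventuallyEq hloc rfl
  have hlim : Tendsto φ (𝓝[>] 0) (𝓝 (φ 0)) :=
    ((hφc 0 ⟨le_rfl, ht.1⟩).mono_left (by
      rw [← nhdsWithin_Ioc_eq_nhdsGT ht0]
      exact nhdsWithin_mono _ Set.Ioc_subset_Icc_self))
  have hlim' : Tendsto φ (𝓝[>] 0) (𝓝 (φ t)) :=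
    tendsto_const_nhds.congr' (by
      filter_upwards [Ioc_mem_nhdsGT ht0] with a ha using hconst a ha.1 ha.2)
  have := tendsto_nhds_unique hlim' hlim
  simp only [hφ, hx0, travelTime, intervalIntegral.integral_same, sub_zero] at this
  simp only [travelTime]
  linarith

end IsDirectionPath

/-! ### Transfer of measures between positions and travel times -/

section Transfer

theorem strictMono_travelTime (hpos : ∀ w, 0 < c w)
    (hint : ∀ x, IntervalIntegrable (fun w => 1 / c w) volume 0 x) :
    StrictMono (travelTime c) := by
  intro x y hxy
  have := intervalIntegral.intervalIntegral_pos_of_pos_on ((hint x).symm.trans (hint y))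
    (fun r _ => one_div_pos.2 (hpos r)) hxy
  rw [← travelTime_sub hint] at this
  linarith

theorem measurableEmbedding_travelTime (hpos : ∀ w, 0 < c w)
    (hint : ∀ x, IntervalIntegrable (fun w => 1 / c w) volume 0 x) :
    MeasurableEmbedding (travelTime c) :=
  (continuous_travelTime hint).measurableEmbedding (strictMono_travelTime hpos hint).injective

/-- The change of variables on `(-n, n]`, exhausted as `n` grows. The image is restricted to the
range because the total travel time to infinity may be finite. -/
theorem map_travelTime (hpos : ∀ w, 0 < c w)
    (hint : ∀ x, IntervalIntegrable (fun w => 1 / c w) volume 0 x) :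
    (volume.withDensity fun w => ENNReal.ofReal (1 / c w)).map (travelTime c) =
      volume.restrict (Set.range (travelTime c)) := by
  have hmono := strictMono_travelTime hpos hint
  have hemb := measurableEmbedding_travelTime hpos hint
  have hn : ∀ n : ℕ, ((volume.restrict (Set.Ioc (-(n : ℝ)) n)).withDensity
      fun w => ENNReal.ofReal (1 / c w)).map (travelTime c) =
      volume.restrict (Set.Ioc (travelTime c (-(n : ℝ))) (travelTime c n)) := fun n =>
    map_withDensity_of_primitive (by linarith [Nat.cast_nonneg (α := ℝ) n])
      (fun s => one_div_pos.2 (hpos s)) ((hint _).symm.trans (hint _)) fun s _ => by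
        rw [← travelTime_sub hint]; ring
  have hunion : ⋃ n : ℕ, Set.Ioc (-(n : ℝ)) n = Set.univ := by
    refine Set.eq_univ_of_forall fun x => Set.mem_iUnion.2 ?_
    obtain ⟨n, hn⟩ := exists_nat_gt |x|
    exact ⟨n, by linarith [neg_abs_le x], by linarith [le_abs_self x]⟩
  have hunion' : Set.range (travelTime c) ⊆
      ⋃ n : ℕ, Set.Ioc (travelTime c (-(n : ℝ))) (travelTime c n) := by
    rintro _ ⟨x, rfl⟩
    have : x ∈ ⋃ n : ℕ, Set.Ioc (-(n : ℝ)) n := hunion ▸ Set.mem_univ x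
    obtain ⟨n, hn⟩ := Set.mem_iUnion.1 this
    exact Set.mem_iUnion.2 ⟨n, hmono hn.1, hmono.monotone hn.2⟩
  have hunion'' : ⋃ n : ℕ, Set.Ioc (travelTime c (-(n : ℝ))) (travelTime c n) =
      Set.range (travelTime c) := by
    refine subset_antisymm (Set.iUnion_subset fun n => ?_) hunion'
    refine Set.Ioc_subset_Icc_self.trans ?_
    exact (isPreconnected_range (continuous_travelTime hint)).Icc_subset
      (Set.mem_range_self _) (Set.mem_range_self _)
  have hle : Monotone fun n : ℕ => Set.Ioc (-(n : ℝ)) n := fun n m hnm => by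
    have : (n : ℝ) ≤ m := by exact_mod_cast hnm
    exact Set.Ioc_subset_Ioc (by linarith) this
  have hle' : Monotone fun n : ℕ => Set.Ioc (travelTime c (-(n : ℝ))) (travelTime c n) :=
    fun n m hnm => by
      have : (n : ℝ) ≤ m := by exact_mod_cast hnm
      exact Set.Ioc_subset_Ioc (hmono.monotone (by linarith)) (hmono.monotone this)
  ext B hB
  rw [← hunion'', Measure.restrict_iUnion_apply_eq_iSup hle'.directed_le hB,
    hemb.map_apply, ← Measure.restrict_univ (μ := volume.withDensity _), ← hunion,
    Measure.restrict_iUnion_apply_eq_iSup hle.directed_le (hemb.measurable hB)]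
  refine iSup_congr fun n => ?_
  rw [← hn n, hemb.map_apply, restrict_withDensity measurableSet_Ioc]

/-- The measure on positions with density `g(τ(x)) / c(x)` on `{|τ| < t}` corresponds to the
density `g` on `(-t, t)`. -/
theorem map_travelTime_withDensity (hc : Measurable c) (hpos : ∀ w, 0 < c w)
    (hint : ∀ x, IntervalIntegrable (fun w => 1 / c w) volume 0 x) {t : ℝ} {p g : ℝ → ℝ}
    (hg : Measurable g) (hpg : ∀ x, |travelTime c x| < t → c x * p x = g (travelTime c x)) :
    ((volume.restrict (support c t)).withDensity fun x => ENNReal.ofReal (p x)).map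
        (travelTime c) =
      ((volume.restrict (Set.Ioo (-t) t)).withDensity fun z => ENNReal.ofReal (g z)).restrict
        (Set.range (travelTime c)) := by
  have hemb := measurableEmbedding_travelTime hpos hint
  have hsupp : support c t = travelTime c ⁻¹' Set.Ioo (-t) t := by
    ext x; simp [support, abs_lt]
  have hdens : Measurable fun w => ENNReal.ofReal (1 / c w) := by fun_prop
  ext B hB
  rw [hemb.map_apply, withDensity_apply _ (hemb.measurable hB), Measure.restrict_apply hB,
    withDensity_apply _ (hB.inter hemb.measurableSet_range),
    Measure.restrict_restrict (hB.inter hemb.measurableSet_range),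
    Measure.restrict_restrict (hemb.measurable hB), hsupp, ← Set.preimage_inter]
  have h1 : ∫⁻ x in travelTime c ⁻¹' (B ∩ Set.Ioo (-t) t), ENNReal.ofReal (p x) =
      ∫⁻ x in travelTime c ⁻¹' (B ∩ Set.Ioo (-t) t),
        ((fun w => ENNReal.ofReal (1 / c w)) * fun x => ENNReal.ofReal (g (travelTime c x))) x := by
    refine setLIntegral_congr_fun (hemb.measurable (hB.inter measurableSet_Ioo)) fun x hx => ?_
    rw [Pi.mul_apply, ← hpg x (abs_lt.2 hx.2), ← ENNReal.ofReal_mul (one_div_pos.2 (hpos x)).le]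
    congr 1
    have := (hpos x).ne'
    field_simp
  have hm : Measurable fun x => ENNReal.ofReal (g (travelTime c x)) :=
    (hg.comp hemb.measurable).ennreal_ofReal
  rw [h1, ← setLIntegral_withDensity_eq_setLIntegral_mul _ hdens hm (hemb.measurable (hB.inter measurableSet_Ioo)),
    ← setLIntegral_map (hB.inter measurableSet_Ioo) hg.ennreal_ofReal hemb.measurable,
    map_travelTime hpos hint, Measure.restrict_restrict (hB.inter measurableSet_Ioo)]
  congr 2
  ext; simp only [Set.mem_inter_iff]; tauto

end Transfer

end

/-! ### Riemann sums of the direction -/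

theorem gridPoint_eq {n i : ℕ} {y : ℝ}
    (hy : y ∈ Set.Ioo ((i : ℝ) / (n + 1)) ((i + 1 : ℝ) / (n + 1))) :
    gridPoint n y = (i + 1 : ℝ) / (n + 1) := by
  have h : (0 : ℝ) < (n : ℝ) + 1 := by positivity
  have : ⌊((n : ℝ) + 1) * y⌋ = i := by
    rw [Int.floor_eq_iff]
    have h1 := (div_lt_iff₀ h).1 hy.1
    have h2 := (lt_div_iff₀ h).1 hy.2
    push_cast
    exact ⟨by linarith, by linarith⟩
  rw [gridPoint, this]
  push_cast
  rfl

theorem measurable_comp_gridPoint (f : ℝ → ℝ) (n : ℕ) : Measurable fun y => f (gridPoint n y) := by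
  have h1 : Measurable fun k : ℤ => f (((k : ℝ) + 1) / ((n : ℝ) + 1)) := measurable_of_countable _
  have h2 : Measurable fun s : ℝ => (⌊((n : ℝ) + 1) * s⌋ : ℤ) := by fun_prop
  exact h1.comp h2

/-- A right-endpoint Riemann sum is the integral of a step function exactly, so convergence of
Riemann sums becomes dominated convergence. -/
theorem integral_comp_gridPoint (f : ℝ → ℝ) (n : ℕ) :
    ∫ y in (0 : ℝ)..1, f (gridPoint n y) =
      1 / ((n : ℝ) + 1) * ∑ i ∈ Finset.range (n + 1), f ((i + 1 : ℝ) / (n + 1)) := by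
  have h : (0 : ℝ) < (n : ℝ) + 1 := by positivity
  have hle : ∀ i : ℕ, (i : ℝ) / (n + 1) ≤ (i + 1 : ℝ) / (n + 1) := fun i => by
    gcongr; linarith
  have hcell : ∀ i : ℕ, Set.EqOn (fun y => f (gridPoint n y))
      (fun _ => f ((i + 1 : ℝ) / (n + 1)))
      (Set.Ioo ((i : ℝ) / (n + 1)) ((i + 1 : ℝ) / (n + 1))) := fun i y hy => by
    simp only [gridPoint_eq hy]
  have hint : ∀ i : ℕ, IntervalIntegrable (fun y => f (gridPoint n y)) volume
      ((i : ℝ) / (n + 1)) (((i + 1 : ℕ) : ℝ) / (n + 1)) := fun i => by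
    rw [Nat.cast_add_one, intervalIntegrable_iff_integrableOn_Ioo_of_le (hle i),
      integrableOn_congr_fun (hcell i) measurableSet_Ioo]
    exact integrableOn_const (by simp)
  have hsum := intervalIntegral.sum_integral_adjacent_intervals (n := n + 1)
    (a := fun i : ℕ => (i : ℝ) / (n + 1)) fun k _ => hint k
  simp only [Nat.cast_zero, zero_div, Nat.cast_add_one, div_self h.ne'] at hsum
  rw [← hsum, Finset.mul_sum]
  refine Finset.sum_congr rfl fun i _ => ?_
  rw [intervalIntegral.integral_of_le (hle i), integral_Ioc_eq_integral_Ioo,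
    setIntegral_congr_fun measurableSet_Ioo (hcell i), setIntegral_const, Measure.real,
    Real.volume_Ioo, ENNReal.toReal_ofReal (sub_nonneg.2 (hle i)), smul_eq_mul]
  congr 1
  field_simp
  ring

/-- Riemann sums of a bounded right-continuous function converge to its integral. -/
theorem tendsto_riemann_sum {f : ℝ → ℝ} {C : ℝ} (hC : ∀ y, 0 < y → |f y| ≤ C)
    (hf : ∀ y, 0 < y → Tendsto f (𝓝[>] y) (𝓝 (f y))) :
    Tendsto (fun n : ℕ => 1 / ((n : ℝ) + 1) *
      ∑ i ∈ Finset.range (n + 1), f ((i + 1 : ℝ) / (n + 1))) atTop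
      (𝓝 (∫ y in (0 : ℝ)..1, f y)) := by
  simp_rw [← integral_comp_gridPoint]
  refine intervalIntegral.tendsto_integral_filter_of_dominated_convergence (fun _ => C)
    (Eventually.of_forall fun n => (measurable_comp_gridPoint f n).aestronglyMeasurable)
    (Eventually.of_forall fun n => ae_of_all _ fun y hy => ?_) (by simp)
    (ae_of_all _ fun y hy => ?_)
  all_goals rw [Set.uIoc_of_le zero_le_one] at hy
  · exact hC _ (hy.1.trans (lt_gridPoint n y))
  · exact (hf y hy.1).comp (tendsto_gridPoint y)

/-- The points `e + (i + 1) (s - e) / (n + 1)`, which divide `(e, s]` into `n + 1` equal parts. -/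
def partitionPoint (e s : ℝ) (n i : ℕ) : ℝ := e + (s - e) * ((i + 1 : ℝ) / (n + 1))

section PartitionPoint

variable {e s : ℝ}

theorem partitionPoint_last (e s : ℝ) (n : ℕ) : partitionPoint e s n n = s := by
  have h : (n : ℝ) + 1 ≠ 0 := by positivity
  rw [partitionPoint, div_self h]; ring

theorem monotone_partitionPoint (hes : e ≤ s) (n : ℕ) : Monotone (partitionPoint e s n) := by
  intro i j hij
  have : (i : ℝ) ≤ j := by exact_mod_cast hij
  have h : 0 ≤ s - e := by linarith
  unfold partitionPoint
  gcongr

theorem lt_partitionPoint (hes : e < s) (n i : ℕ) : e < partitionPoint e s n i := by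
  have h : 0 < s - e := by linarith
  unfold partitionPoint
  have : 0 < (s - e) * ((i + 1 : ℝ) / (n + 1)) := by positivity
  linarith

theorem tendsto_partitionPoint_zero (hes : e < s) :
    Tendsto (fun n => partitionPoint e s n 0) atTop (𝓝[≥] e) := by
  refine tendsto_nhdsWithin_iff.2
    ⟨?_, Eventually.of_forall fun n => (lt_partitionPoint hes n 0).le⟩
  unfold partitionPoint
  simpa using tendsto_const_nhds.add ((tendsto_one_div_add_atTop_nhds_zero_nat (𝕜 := ℝ)).const_mul
    (s - e))

end PartitionPoint

theorem ncard_inter_Ioc_add {S : Set ℝ} {a b d : ℝ} (hab : a ≤ b) (hbd : b ≤ d)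
    (hfin : (S ∩ Set.Ioc a d).Finite) :
    (S ∩ Set.Ioc a b).ncard + (S ∩ Set.Ioc b d).ncard = (S ∩ Set.Ioc a d).ncard := by
  rw [← Set.Ioc_union_Ioc_eq_Ioc hab hbd, Set.inter_union_distrib_left] at hfin ⊢
  refine (Set.ncard_union_eq ?_ (hfin.subset Set.subset_union_left)
    (hfin.subset Set.subset_union_right)).symm
  exact (Set.Ioc_disjoint_Ioc_of_le le_rfl).mono Set.inter_subset_right Set.inter_subset_right

theorem sum_ncard_inter_Ioc {S : Set ℝ} {r : ℕ → ℝ} (hr : Monotone r)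
    (hfin : ∀ b, (S ∩ Set.Ioc (r 0) b).Finite) (i : ℕ) :
    ∑ j ∈ Finset.range i, (S ∩ Set.Ioc (r j) (r (j + 1))).ncard =
      (S ∩ Set.Ioc (r 0) (r i)).ncard := by
  induction i with
  | zero => simp
  | succ i ih =>
    rw [Finset.sum_range_succ, ih,
      ncard_inter_Ioc_add (hr (Nat.zero_le i)) (hr (Nat.le_succ i)) (hfin _)]

/-- The Riemann sum of the direction on `(e, s]` relative to the direction at time `e`, as a
function of the numbers of reversals between partition points. -/
def signSum (e s : ℝ) (n : ℕ) (N : ℕ → ℕ) : ℝ :=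
  (s - e) * (1 / ((n : ℝ) + 1) * ∑ i ∈ Finset.range (n + 1), (-1) ^ ∑ j ∈ Finset.range i, N j)

theorem abs_signSum_le {e s : ℝ} (hes : e ≤ s) (n : ℕ) (N : ℕ → ℕ) :
    |signSum e s n N| ≤ s - e := by
  have h : (0 : ℝ) < (n : ℝ) + 1 := by positivity
  rw [signSum, abs_mul, abs_of_nonneg (sub_nonneg.2 hes)]
  refine mul_le_of_le_one_right (sub_nonneg.2 hes) ?_
  rw [abs_mul, abs_of_pos (one_div_pos.2 h), one_div, inv_mul_le_one₀ h]
  refine (Finset.abs_sum_le_sum_abs _ _).trans ?_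
  simp [abs_pow]

theorem signSum_congr {e s : ℝ} {n : ℕ} {N N' : ℕ → ℕ} (h : ∀ j < n, N j = N' j) :
    signSum e s n N = signSum e s n N' := by
  unfold signSum
  congr 2
  refine Finset.sum_congr rfl fun i hi => ?_
  congr 1
  refine Finset.sum_congr rfl fun j hj => h j ?_
  rw [Finset.mem_range] at hi hj
  omega

theorem measurable_signSum (e s : ℝ) (n : ℕ) : Measurable (signSum e s n) := by
  unfold signSum
  refine Measurable.const_mul (Measurable.const_mul ?_ _) _
  refine Finset.measurable_sum _ fun i _ => ?_
  have h : Measurable fun N : ℕ → ℕ => ∑ j ∈ Finset.range i, N j :=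
    Finset.measurable_sum _ fun j _ => measurable_pi_apply j
  exact (measurable_of_countable fun k : ℕ => (-1 : ℝ) ^ k).comp h

/-- All partition points exceed `e`, so for `e = 0` only counts over intervals away from time `0`
occur, the ones whose joint law is prescribed. -/
theorem IsDirectionPath.tendsto_signSum {S : Set ℝ} {V : ℝ → ℝ} (h : IsDirectionPath S V)
    {e s : ℝ} (he : 0 ≤ e) (hes : e < s) (hfin : (S ∩ Set.Ioc e s).Finite)
    (hrev : ∀ r, e ≤ r → V r = V e * (-1) ^ (S ∩ Set.Ioc e r).ncard) :
    Tendsto (fun n => V e * signSum e s n fun j =>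
      (S ∩ Set.Ioc (partitionPoint e s n j) (partitionPoint e s n (j + 1))).ncard) atTop
      (𝓝 (∫ r in e..s, V r)) := by
  have hse : 0 < s - e := sub_pos.2 hes
  have hr := tendsto_riemann_sum (f := fun y => V (e + (s - e) * y)) (C := 1)
    (fun y hy => (h.abs_eq_one (by positivity)).le)
    (fun y hy => by
      refine (h.tendsto_right (s := e + (s - e) * y) (by positivity)).comp ?_
      refine tendsto_nhdsWithin_iff.2 ⟨?_, ?_⟩
      · exact ((by fun_prop : Continuous fun y => e + (s - e) * y).tendsto y).mono_left
          nhdsWithin_le_nhds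
      · filter_upwards [self_mem_nhdsWithin] with z (hz : y < z)
        exact add_lt_add_right (mul_lt_mul_of_pos_left hz hse) e)
  have hI := intervalIntegral.smul_integral_comp_add_mul (a := 0) (b := 1) V (s - e) e
  rw [mul_zero, mul_one, add_zero, add_sub_cancel, smul_eq_mul] at hI
  rw [← hI]
  refine (hr.const_mul (s - e)).congr' ?_
  -- For large `n` there is no reversal between `e` and the first partition point, so omitting that
  -- cell does not change the parities.
  filter_upwards [(tendsto_partitionPoint_zero hes).eventually
    (eventually_inter_Ioc_eq_empty hes hfin)] with n hn
  have hmono := monotone_partitionPoint hes.le n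
  have h0 : 0 < partitionPoint e s n 0 := he.trans_lt (lt_partitionPoint hes n 0)
  rw [signSum, mul_left_comm (V e), mul_left_comm (V e), Finset.mul_sum _ _ (V e)]
  congr 2
  refine Finset.sum_congr rfl fun i hi => ?_
  have hi' : partitionPoint e s n i ≤ s :=
    (hmono (Nat.lt_succ_iff.1 (Finset.mem_range.1 hi))).trans (partitionPoint_last e s n).le
  rw [sum_ncard_inter_Ioc hmono (fun b => h.finite _ b h0)]
  have hcount := ncard_inter_Ioc_add (lt_partitionPoint hes n 0).le (hmono (Nat.zero_le i))
    (hfin.subset (Set.inter_subset_inter_right _ (Set.Ioc_subset_Ioc_right hi')))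
  rw [hn, Set.ncard_empty, zero_add] at hcount
  rw [hcount, ← hrev _ (lt_partitionPoint hes n i).le]
  rfl

/-! ### Independence of past displacement and later reversals -/

section Probability

variable {Ω : Type*} [MeasurableSpace Ω] {P : Measure Ω}

theorem ae_eq_one_or_neg_one [IsProbabilityMeasure P] {U : Ω → ℝ} (hU : Measurable U)
    (h1 : P {ω | U ω = 1} = 1 / 2) (h2 : P {ω | U ω = -1} = 1 / 2) :
    ∀ᵐ ω ∂P, U ω = 1 ∨ U ω = -1 := by
  have hm1 : MeasurableSet {ω | U ω = 1} := hU (measurableSet_singleton 1)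
  have hm2 : MeasurableSet {ω | U ω = -1} := hU (measurableSet_singleton (-1))
  have hunion : P ({ω | U ω = 1} ∪ {ω | U ω = -1}) = 1 := by
    rw [measure_union _ hm2, h1, h2, ENNReal.add_halves]
    exact Set.disjoint_left.2 fun ω (h : U ω = 1) (h' : U ω = -1) => by norm_num [h] at h'
  exact (mem_ae_iff_prob_eq_one (hm1.union hm2)).2 hunion

/-- Conditioning on a symmetric sign. -/
theorem integral_eq_of_symmetric_sign [IsProbabilityMeasure P]
    {U A B F : Ω → ℝ} (hU : Measurable U)
    (h1 : P {ω | U ω = 1} = 1 / 2) (h2 : P {ω | U ω = -1} = 1 / 2)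
    (hA : Integrable A P) (hB : Integrable B P) (hUA : IndepFun U A P) (hUB : IndepFun U B P)
    (hFA : ∀ ω, U ω = 1 → F ω = A ω) (hFB : ∀ ω, U ω = -1 → F ω = B ω) :
    ∫ ω, F ω ∂P = (∫ ω, A ω ∂P + ∫ ω, B ω ∂P) / 2 := by
  have hae := ae_eq_one_or_neg_one hU h1 h2
  have key : ∀ (v : ℝ) (D : Ω → ℝ), Integrable D P → IndepFun U D P →
      P {ω | U ω = v} = 1 / 2 →
      Integrable (fun ω => Set.indicator {v} (fun _ => (1 : ℝ)) (U ω) * D ω) P ∧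
      ∫ ω, Set.indicator {v} (fun _ => (1 : ℝ)) (U ω) * D ω ∂P = (∫ ω, D ω ∂P) / 2 := by
    intro v D hD hUD hv
    have hφ : Measurable (Set.indicator {v} fun _ : ℝ => (1 : ℝ)) :=
      measurable_const.indicator (measurableSet_singleton v)
    have hmv : MeasurableSet {ω | U ω = v} := hU (measurableSet_singleton v)
    have heq : (fun ω => Set.indicator {v} (fun _ => (1 : ℝ)) (U ω)) =
        Set.indicator {ω | U ω = v} fun _ => 1 := by
      funext ω; by_cases h : U ω = v <;> simp [h]
    refine ⟨hD.bdd_mul (c := 1) (hφ.comp hU).aestronglyMeasurable (ae_of_all _ fun ω => ?_), ?_⟩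
    · by_cases h : U ω = v <;> simp [h]
    · have := (hUD.comp hφ measurable_id).integral_fun_mul_eq_mul_integral
        (hφ.comp hU).aestronglyMeasurable hD.aestronglyMeasurable
      simp only [Function.comp, id] at this
      rw [this, heq, integral_indicator hmv, setIntegral_const, Measure.real, hv]
      simp; ring
  obtain ⟨hi1, he1⟩ := key 1 A hA hUA h1
  obtain ⟨hi2, he2⟩ := key (-1) B hB hUB h2
  rw [add_div, ← he1, ← he2, ← integral_add hi1 hi2]
  refine integral_congr_ae ?_
  filter_upwards [hae] with ω hω
  rcases hω with h | h
  · have h' : ¬ (1 : ℝ) = -1 := by norm_num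
    rw [hFA ω h]; simp [h, h']
  · have h' : ¬ (-1 : ℝ) = 1 := by norm_num
    rw [hFB ω h]; simp [h, h']

/-- The alternating exponential series contributes one factor `exp(-r)`, the Poisson normalisation
the other. -/
theorem integral_neg_one_pow_poissonMeasure (r : NNReal) :
    ∫ n : ℕ, (-1 : ℝ) ^ n ∂(poissonMeasure r) = Real.exp (-2 * r) := by
  rw [integral_poissonMeasure]
  have h := (NormedSpace.expSeries_div_hasSum_exp (-(r : ℝ))).mul_left (Real.exp (-r))
  rw [← Real.exp_eq_exp_ℝ, ← Real.exp_add] at h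
  rw [show (-2 * r : ℝ) = -r + -r by ring, ← h.tsum_eq]
  refine tsum_congr fun n => ?_
  rw [smul_eq_mul, neg_pow (r : ℝ)]
  ring

variable {rate : ℝ → ℝ} {S : Ω → Set ℝ} {V : ℝ → Ω → ℝ}

theorem IsPoissonProcess.integral_neg_one_pow_count (hS : IsPoissonProcess P rate S) {a b : ℝ}
    (ha : 0 < a) (hab : a ≤ b) (hrate : 0 ≤ ∫ s in a..b, rate s) :
    ∫ ω, (-1 : ℝ) ^ count S a b ω ∂P = Real.exp (-2 * ∫ s in a..b, rate s) := by
  have h := (hS.poisson_law a b ha hab).integral_comp (f := fun n : ℕ => (-1 : ℝ) ^ n)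
    (measurable_of_countable _).aestronglyMeasurable
  simp only [Function.comp_def] at h
  rw [h, integral_neg_one_pow_poissonMeasure, Real.coe_toNNReal _ hrate]

theorem IsPoissonProcess.aemeasurable_count (hS : IsPoissonProcess P rate S) {a b : ℝ}
    (ha : 0 < a) (hab : a ≤ b) : AEMeasurable (count S a b) P :=
  (hS.poisson_law a b ha hab).aemeasurable

/-- The Riemann sums of the direction up to time `s` are independent of the reversals
after time `s`. -/
theorem IsPoissonProcess.indepFun_signSum (hS : IsPoissonProcess P rate S) {e s t : ℝ}
    (he : 0 ≤ e) (hes : e < s) (hst : s ≤ t) (n : ℕ) :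
    IndepFun (fun ω => signSum e s n fun j =>
        count S (partitionPoint e s n j) (partitionPoint e s n (j + 1)) ω)
      (count S s t) P := by
  set r := partitionPoint e s n with hr
  -- The partition of `(e, s]` continued by `t`: increments with index below `n` determine the
  -- Riemann sum, and increment `n` runs from `s` to `t`.
  set τ : ℕ → ℝ := fun i => if i ≤ n then r i else t with hτ
  have hrm : Monotone r := monotone_partitionPoint hes.le n
  have hτm : Monotone τ := by
    intro i j hij
    simp only [hτ]
    by_cases hj : j ≤ n
    · rw [if_pos (hij.trans hj), if_pos hj]; exact hrm hij
    · rw [if_neg hj]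
      by_cases hi : i ≤ n
      · rw [if_pos hi]
        exact (hrm hi).trans ((partitionPoint_last e s n).le.trans hst)
      · rw [if_neg hi]
  have hτ0 : 0 < τ 0 := by
    simp only [hτ, Nat.zero_le, if_true]
    exact he.trans_lt (lt_partitionPoint hes n 0)
  have hpos : ∀ i, 0 < τ i := fun i => hτ0.trans_le (hτm (Nat.zero_le i))
  have hind := (hS.indep_increments τ hτ0 hτm).indepFun_finset₀ (Finset.range n) {n} (by simp)
    fun i => hS.aemeasurable_count (hpos i) (hτm (Nat.le_succ i))
  let φ : ((i : Finset.range n) → ℕ) → ℝ := fun N =>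
    signSum e s n fun j => if hj : j ∈ Finset.range n then N ⟨j, hj⟩ else 0
  have hφ : Measurable φ := by
    refine (measurable_signSum e s n).comp (measurable_pi_iff.2 fun j => ?_)
    by_cases hj : j ∈ Finset.range n
    · simp only [hj, dite_true]; exact measurable_pi_apply _
    · simp only [hj, dite_false]; exact measurable_const
  have := hind.comp hφ (measurable_pi_apply (⟨n, Finset.mem_singleton_self n⟩ : ({n} : Finset ℕ)))
  convert this using 1
  · funext ω
    refine signSum_congr fun j hj => ?_
    rw [dif_pos (Finset.mem_range.2 hj)]
    simp only [hτ, if_pos hj.le, if_pos (Nat.succ_le_of_lt hj)]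
  · funext ω
    simp only [Function.comp, hτ, le_refl, if_true, if_neg (Nat.not_succ_le_self n), hr,
      partitionPoint_last]

theorem IsPoissonProcess.aemeasurable_signSum (hS : IsPoissonProcess P rate S) {e s : ℝ}
    (he : 0 ≤ e) (hes : e < s) (n : ℕ) :
    AEMeasurable (fun ω => signSum e s n fun j =>
        count S (partitionPoint e s n j) (partitionPoint e s n (j + 1)) ω) P :=
  (measurable_signSum e s n).comp_aemeasurable (aemeasurable_pi_iff.2 fun j =>
    hS.aemeasurable_count (he.trans_lt (lt_partitionPoint hes n j))
      (monotone_partitionPoint hes.le n (Nat.le_succ j)))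

theorem exp_mul_le_of_abs_le {u z C : ℝ} (hz : |z| ≤ C) : Real.exp (u * z) ≤ Real.exp (|u| * C) :=
  Real.exp_le_exp.2 ((le_abs_self _).trans ((abs_mul u z).trans_le (by gcongr)))

theorem abs_neg_one_pow_eq_one (k : ℕ) : |(-1 : ℝ) ^ k| = 1 := by simp [abs_pow]

section Factorization

variable {I : Set ℝ} {e s t : ℝ}

/-- Conditioning on `V e = ±1`, which is independent of all later counts jointly, replaces `u` by
`±u`. For each sign the factorisation is independence of increments over disjoint intervals, and
both signs share the factor `E (-1)^N`. -/
theorem integral_neg_one_pow_mul_exp_signSum [IsProbabilityMeasure P]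
    (hS : IsPoissonProcess P rate S)
    (hV : IsDirection P I S V) (heI : e ∈ I) (he : 0 ≤ e) (hes : e < s) (hst : s ≤ t)
    (u : ℝ) (n : ℕ) :
    ∫ ω, (-1 : ℝ) ^ count S s t ω * Real.exp (u * (V e ω * signSum e s n fun j =>
        count S (partitionPoint e s n j) (partitionPoint e s n (j + 1)) ω)) ∂P =
      (∫ ω, (-1 : ℝ) ^ count S s t ω ∂P) * ∫ ω, Real.exp (u * (V e ω * signSum e s n fun j =>
        count S (partitionPoint e s n j) (partitionPoint e s n (j + 1)) ω)) ∂P := by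
  set A : Ω → ℝ := fun ω => signSum e s n fun j =>
    count S (partitionPoint e s n j) (partitionPoint e s n (j + 1)) ω with hA
  have hAm : AEMeasurable A P := hS.aemeasurable_signSum he hes n
  have hAle : ∀ ω, |A ω| ≤ s - e := fun ω => abs_signSum_le hes.le _ _
  have hs0 : 0 < s := he.trans_lt hes
  have hNm : AEMeasurable (fun ω => (-1 : ℝ) ^ count S s t ω) P :=
    (measurable_of_countable fun k : ℕ => (-1 : ℝ) ^ k).comp_aemeasurable
      (hS.aemeasurable_count hs0 hst)
  have hEm : ∀ v : ℝ, AEMeasurable (fun ω => Real.exp (v * A ω)) P := fun v =>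
    (by fun_prop : Measurable fun z => Real.exp (v * z)).comp_aemeasurable hAm
  have hEi : ∀ v : ℝ, Integrable (fun ω => Real.exp (v * A ω)) P := fun v =>
    Integrable.of_bound (hEm v).aestronglyMeasurable (Real.exp (|v| * (s - e)))
      (ae_of_all _ fun ω => by
        rw [Real.norm_eq_abs, Real.abs_exp]; exact exp_mul_le_of_abs_le (hAle ω))
  have hNE : ∀ v : ℝ, Integrable (fun ω => (-1 : ℝ) ^ count S s t ω * Real.exp (v * A ω)) P :=
    fun v => (hEi v).bdd_mul (c := 1) hNm.aestronglyMeasurable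
      (ae_of_all _ fun ω => (abs_neg_one_pow_eq_one _).le)
  -- the sums are functions of the increments after time `e`
  let q : ℕ → {q : ℝ × ℝ // e < q.1 ∧ q.1 ≤ q.2} := fun j =>
    ⟨(partitionPoint e s n j, partitionPoint e s n (j + 1)), lt_partitionPoint hes n j,
      monotone_partitionPoint hes.le n (Nat.le_succ j)⟩
  let q' : {q : ℝ × ℝ // e < q.1 ∧ q.1 ≤ q.2} := ⟨(s, t), hes, hst⟩
  have hψ : Measurable fun N : {q : ℝ × ℝ // e < q.1 ∧ q.1 ≤ q.2} → ℕ =>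
      signSum e s n fun j => N (q j) :=
    (measurable_signSum e s n).comp (measurable_pi_iff.2 fun j => measurable_pi_apply (q j))
  have hψ' : Measurable fun N : {q : ℝ × ℝ // e < q.1 ∧ q.1 ≤ q.2} → ℕ => (-1 : ℝ) ^ N q' :=
    (measurable_of_countable fun k : ℕ => (-1 : ℝ) ^ k).comp (measurable_pi_apply q')
  have hind1 : ∀ v : ℝ, IndepFun (V e) (fun ω => Real.exp (v * A ω)) P := fun v =>
    (hV.indep e heI).comp measurable_id (Real.measurable_exp.comp (hψ.const_mul v))
  have hind2 : ∀ v : ℝ, IndepFun (V e)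
      (fun ω => (-1 : ℝ) ^ count S s t ω * Real.exp (v * A ω)) P := fun v =>
    (hV.indep e heI).comp measurable_id (hψ'.mul (Real.measurable_exp.comp (hψ.const_mul v)))
  have hind3 : ∀ v : ℝ, ∫ ω, (-1 : ℝ) ^ count S s t ω * Real.exp (v * A ω) ∂P =
      (∫ ω, (-1 : ℝ) ^ count S s t ω ∂P) * ∫ ω, Real.exp (v * A ω) ∂P := fun v =>
    ((hS.indepFun_signSum he hes hst n).symm.comp
      (measurable_of_countable fun k : ℕ => (-1 : ℝ) ^ k)
      (by fun_prop : Measurable fun z => Real.exp (v * z))).integral_fun_mul_eq_mul_integral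
        hNm.aestronglyMeasurable (hEm v).aestronglyMeasurable
  rw [integral_eq_of_symmetric_sign (hV.measurable e) (hV.forward e heI) (hV.backward e heI)
    (hNE u) (hNE (-u)) (hind2 u) (hind2 (-u))
    (F := fun ω => (-1 : ℝ) ^ count S s t ω * Real.exp (u * (V e ω * A ω)))
    (fun ω h => by simp only [h, one_mul]) (fun ω h => by simp only [h, neg_mul, one_mul, mul_neg]),
    integral_eq_of_symmetric_sign (hV.measurable e) (hV.forward e heI) (hV.backward e heI)
    (hEi u) (hEi (-u)) (hind1 u) (hind1 (-u))
    (F := fun ω => Real.exp (u * (V e ω * A ω)))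
    (fun ω h => by simp only [h, one_mul]) (fun ω h => by simp only [h, neg_mul, one_mul, mul_neg]),
    hind3 u, hind3 (-u)]
  ring

/-- The displacement `∫_e^s V` is independent of the parity of the number of reversals after
time `s`, in the sense of exponential moments. -/
theorem integral_neg_one_pow_mul_exp_integral [IsProbabilityMeasure P]
    (hS : IsPoissonProcess P rate S)
    (hV : IsDirection P I S V) (heI : e ∈ I) (he : 0 ≤ e) (hes : e < s) (hst : s ≤ t)
    (hpath : ∀ᵐ ω ∂P, IsDirectionPath (S ω) fun r => V r ω)
    (hfin : ∀ᵐ ω ∂P, (S ω ∩ Set.Ioc e s).Finite) (u : ℝ) :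
    AEStronglyMeasurable (fun ω => Real.exp (u * ∫ r in e..s, V r ω)) P ∧
    ∫ ω, (-1 : ℝ) ^ count S s t ω * Real.exp (u * ∫ r in e..s, V r ω) ∂P =
      (∫ ω, (-1 : ℝ) ^ count S s t ω ∂P) * ∫ ω, Real.exp (u * ∫ r in e..s, V r ω) ∂P := by
  set Z : ℕ → Ω → ℝ := fun n ω => V e ω * signSum e s n fun j =>
    count S (partitionPoint e s n j) (partitionPoint e s n (j + 1)) ω with hZ
  have hs0 : 0 < s := he.trans_lt hes
  have hNm : AEMeasurable (fun ω => (-1 : ℝ) ^ count S s t ω) P :=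
    (measurable_of_countable fun k : ℕ => (-1 : ℝ) ^ k).comp_aemeasurable
      (hS.aemeasurable_count hs0 hst)
  have hlim : ∀ᵐ ω ∂P, Tendsto (fun n => Real.exp (u * Z n ω)) atTop
      (𝓝 (Real.exp (u * ∫ r in e..s, V r ω))) := by
    filter_upwards [hpath, hfin, hV.reversal] with ω hω hω' hrev
    exact (Real.continuous_exp.tendsto _).comp
      ((hω.tendsto_signSum he hes hω' fun r hr => hrev e heI r hr).const_mul u)
  have hm : ∀ n, AEStronglyMeasurable (fun ω => Real.exp (u * Z n ω)) P := fun n =>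
    ((by fun_prop : Measurable fun z => Real.exp (u * z)).comp_aemeasurable
      ((hV.measurable e).aemeasurable.mul
        (hS.aemeasurable_signSum he hes n))).aestronglyMeasurable
  -- `IsDirectionPath` says nothing about the sign at `e = 0`, so it is recovered from the sign at
  -- `s` by undoing the reversals.
  have hsign : ∀ᵐ ω ∂P, V e ω = 1 ∨ V e ω = -1 := by
    filter_upwards [hpath, hV.reversal] with ω hω hrev
    have h1 := hω.sign s hs0
    rw [hrev e heI s hes.le] at h1
    rcases neg_one_pow_eq_or ℝ (count S e s ω) with h | h <;> rw [h] at h1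
    · simpa using h1
    · rcases h1 with h1 | h1
      · right; linarith
      · left; linarith
  have hb : ∀ n, ∀ᵐ ω ∂P, ‖Real.exp (u * Z n ω)‖ ≤ Real.exp (|u| * (s - e)) := fun n => by
    filter_upwards [hsign] with ω hω
    rw [Real.norm_eq_abs, Real.abs_exp]
    refine exp_mul_le_of_abs_le ?_
    have h1 : |V e ω| = 1 := by rcases hω with h | h <;> simp [h]
    rw [hZ]
    simp only [abs_mul, h1, one_mul]
    exact abs_signSum_le hes.le _ _
  have l1 := tendsto_integral_of_dominated_convergence (fun _ => Real.exp (|u| * (s - e))) hm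
    (integrable_const _) hb hlim
  have l2 := tendsto_integral_of_dominated_convergence (fun _ => Real.exp (|u| * (s - e)))
    (F := fun n ω => (-1 : ℝ) ^ count S s t ω * Real.exp (u * Z n ω))
    (fun n => hNm.aestronglyMeasurable.mul (hm n)) (integrable_const _)
    (fun n => by
      filter_upwards [hb n] with ω hω
      rwa [norm_mul, Real.norm_eq_abs, abs_neg_one_pow_eq_one, one_mul])
    (by filter_upwards [hlim] with ω hω using hω.const_mul _)
  refine ⟨aestronglyMeasurable_of_tendsto_ae atTop hm hlim, tendsto_nhds_unique l2 ?_⟩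
  refine (l1.const_mul (∫ ω, (-1 : ℝ) ^ count S s t ω ∂P)).congr fun n => ?_
  exact (integral_neg_one_pow_mul_exp_signSum hS hV heI he hes hst u n).symm

end Factorization

end Probability

/-! ### Rate profiles and the equations for the exponential moments -/

/-- The rate is the logarithmic derivative of a nonnegative increasing solution `h` of
`h'' = λ² h`. -/
structure IsRateProfile (lam : ℝ) (rate h h' : ℝ → ℝ) : Prop where
  deriv : ∀ s, HasDerivAt h (h' s) s
  deriv_deriv : ∀ s, HasDerivAt h' (lam ^ 2 * h s) s
  nonneg : ∀ s, 0 ≤ s → 0 ≤ h' s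
  pos : ∀ s, 0 < s → 0 < h s
  rate_eq : ∀ s, rate s = h' s / h s

theorem isRateProfile_tanh {lam : ℝ} (hlam : 0 < lam) :
    IsRateProfile lam (tanhRate lam) (fun s => Real.cosh (lam * s))
      fun s => lam * Real.sinh (lam * s) where
  deriv s := hasDerivAt_cosh_mul lam s
  deriv_deriv s := by simpa [sq, mul_assoc] using (hasDerivAt_sinh_mul lam s).const_mul lam
  nonneg s hs := mul_nonneg hlam.le (Real.sinh_nonneg_iff.2 (by positivity))
  pos s _ := Real.cosh_pos _
  rate_eq s := by rw [tanhRate, Real.tanh_eq_sinh_div_cosh, mul_div_assoc]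

theorem isRateProfile_coth {lam : ℝ} (hlam : 0 < lam) :
    IsRateProfile lam (cothRate lam) (fun s => Real.sinh (lam * s))
      fun s => lam * Real.cosh (lam * s) where
  deriv s := hasDerivAt_sinh_mul lam s
  deriv_deriv s := by simpa [sq, mul_assoc] using (hasDerivAt_cosh_mul lam s).const_mul lam
  nonneg s _ := mul_nonneg hlam.le (Real.cosh_pos _).le
  pos s hs := Real.sinh_pos_iff.2 (by positivity)
  rate_eq s := by rw [cothRate, mul_div_assoc]

namespace IsRateProfile

variable {lam : ℝ} {rate h h' : ℝ → ℝ}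

theorem continuous (hp : IsRateProfile lam rate h h') : Continuous h :=
  continuous_iff_continuousAt.2 fun s => (hp.deriv s).continuousAt

theorem continuous_deriv (hp : IsRateProfile lam rate h h') : Continuous h' :=
  continuous_iff_continuousAt.2 fun s => (hp.deriv_deriv s).continuousAt

theorem monotoneOn (hp : IsRateProfile lam rate h h') : MonotoneOn h (Set.Ici 0) := by
  refine monotoneOn_of_deriv_nonneg (convex_Ici 0) hp.continuous.continuousOn
    (fun s _ => (hp.deriv s).differentiableAt.differentiableWithinAt) fun s hs => ?_
  rw [(hp.deriv s).deriv]
  rw [interior_Ici] at hs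
  exact hp.nonneg s (le_of_lt hs)

theorem zero_le (hp : IsRateProfile lam rate h h') {s : ℝ} (hs : 0 ≤ s) : 0 ≤ h s := by
  have h0 : 0 ≤ h 0 := by
    have : Tendsto h (𝓝[>] 0) (𝓝 (h 0)) := (hp.continuous.tendsto 0).mono_left nhdsWithin_le_nhds
    refine ge_of_tendsto this ?_
    filter_upwards [self_mem_nhdsWithin] with r hr using (hp.pos r hr).le
  exact h0.trans (hp.monotoneOn Set.self_mem_Ici hs hs)

theorem integral_rate (hp : IsRateProfile lam rate h h') {a b : ℝ} (ha : 0 < a) (hab : a ≤ b) :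
    ∫ s in a..b, rate s = Real.log (h b / h a) := by
  have hpos : ∀ s ∈ Set.uIcc a b, 0 < h s := fun s hs => by
    rw [Set.uIcc_of_le hab] at hs
    exact hp.pos s (ha.trans_le hs.1)
  rw [intervalIntegral.integral_eq_sub_of_hasDerivAt (f := fun s => Real.log (h s)),
    Real.log_div (hp.pos b (ha.trans_le hab)).ne' (hp.pos a ha).ne']
  · intro s hs
    rw [hp.rate_eq]
    exact (hp.deriv s).log (hpos s hs).ne'
  · rw [show rate = fun s => h' s / h s from funext hp.rate_eq]
    exact (hp.continuous_deriv.continuousOn.div hp.continuous.continuousOn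
      fun s hs => (hpos s hs).ne').intervalIntegrable

theorem integral_rate_nonneg (hp : IsRateProfile lam rate h h') {a b : ℝ} (ha : 0 < a)
    (hab : a ≤ b) : 0 ≤ ∫ s in a..b, rate s := by
  rw [hp.integral_rate ha hab]
  refine Real.log_nonneg ((one_le_div (hp.pos a ha)).2 ?_)
  exact hp.monotoneOn ha.le (ha.le.trans hab) hab

theorem exp_neg_integral_rate (hp : IsRateProfile lam rate h h') {a b : ℝ} (ha : 0 < a)
    (hab : a ≤ b) : Real.exp (-∫ s in a..b, rate s) = h a / h b := by
  have h1 := hp.pos a ha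
  have h2 := hp.pos b (ha.trans_le hab)
  rw [hp.integral_rate ha hab, Real.exp_neg, Real.exp_log (div_pos h2 h1), inv_div]

/-- The linear integral equations of the exponential moments determine them. -/
theorem solution_unique (hp : IsRateProfile lam rate h h') {T u κ : ℝ} (hT : 0 < T) (hκ : 0 < κ)
    (hκ2 : κ ^ 2 = u ^ 2 + lam ^ 2) {M W : ℝ → ℝ} (hWi : IntervalIntegrable W volume 0 T)
    (hM : ∀ t ∈ Set.Icc 0 T, M t = 1 + u * ∫ s in (0 : ℝ)..t, W s)
    (hW : ∀ t ∈ Set.Ioo 0 T, W t = u * ∫ s in (0 : ℝ)..t, (h s / h t) ^ 2 * M s) :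
    h T * M T = h 0 * Real.cosh (κ * T) + h' 0 * Real.sinh (κ * T) / κ := by
  have hMc : ContinuousOn M (Set.Icc 0 T) := by
    have := intervalIntegral.continuousOn_primitive_interval' hWi Set.left_mem_uIcc
    rw [Set.uIcc_of_le hT.le] at this
    exact (continuousOn_const.add (continuousOn_const.mul this)).congr hM
  have hhc := hp.continuous
  -- Chosen so that `M' = u W = Q / h²`. With `A = h M` and `B = Q / h + h' M` this gives `A' = B`
  -- and `B' = κ² A`.
  set Q : ℝ → ℝ := fun t => ∫ s in (0 : ℝ)..t, u ^ 2 * (h s ^ 2 * M s) with hQ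
  have hgc : ContinuousOn (fun s => u ^ 2 * (h s ^ 2 * M s)) (Set.Icc 0 T) :=
    continuousOn_const.mul ((hhc.pow 2).continuousOn.mul hMc)
  have hgi : ∀ t ∈ Set.Icc 0 T,
      IntervalIntegrable (fun s => u ^ 2 * (h s ^ 2 * M s)) volume 0 t := fun t ht =>
    (hgc.mono (Set.Icc_subset_Icc_right ht.2)).intervalIntegrable_of_Icc ht.1
  have hQc : ContinuousOn Q (Set.Icc 0 T) := by
    have := intervalIntegral.continuousOn_primitive_interval'
      (hgi T ⟨hT.le, le_rfl⟩) Set.left_mem_uIcc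
    rwa [Set.uIcc_of_le hT.le] at this
  have hnhds : ∀ t ∈ Set.Ioo 0 T, Set.Icc 0 T ∈ 𝓝 t := fun t ht => Icc_mem_nhds ht.1 ht.2
  have hQd : ∀ t ∈ Set.Ioo 0 T, HasDerivAt Q (u ^ 2 * (h t ^ 2 * M t)) t := fun t ht =>
    intervalIntegral.integral_hasDerivAt_right (hgi t (Set.Ioo_subset_Icc_self ht))
      ⟨Set.Icc 0 T, hnhds t ht, hgc.aestronglyMeasurable measurableSet_Icc⟩
      (hgc.continuousAt (hnhds t ht))
  have hWQ : ∀ t ∈ Set.Ioo 0 T, u * W t = Q t / h t ^ 2 := by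
    intro t ht
    have := (hp.pos t ht.1).ne'
    rw [hW t ht, hQ, ← mul_assoc, ← sq, ← intervalIntegral.integral_const_mul,
      ← intervalIntegral.integral_div]
    congr 1
    funext s
    field_simp
  have hWm : ∀ t ∈ Set.Ioo 0 T, HasDerivAt M (Q t / h t ^ 2) t := by
    intro t ht
    have hQh : ContinuousOn (fun s => Q s / h s ^ 2) (Set.Ioo 0 T) :=
      (hQc.mono Set.Ioo_subset_Icc_self).div (hhc.pow 2).continuousOn
        fun s hs => pow_ne_zero 2 (hp.pos s hs.1).ne'
    have huW : ContinuousOn (fun s => u * W s) (Set.Ioo 0 T) := hQh.congr hWQ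
    have hio : Set.Ioo 0 T ∈ 𝓝 t := Ioo_mem_nhds ht.1 ht.2
    have hi : IntervalIntegrable (fun s => u * W s) volume 0 t :=
      (hWi.const_mul u).mono_set (Set.uIcc_subset_uIcc_left
        (Set.Icc_subset_uIcc (Set.Ioo_subset_Icc_self ht)))
    have hd := intervalIntegral.integral_hasDerivAt_right hi
      ⟨Set.Ioo 0 T, hio, huW.aestronglyMeasurable measurableSet_Ioo⟩ (huW.continuousAt hio)
    rw [hWQ t ht] at hd
    refine (hd.const_add 1).congr_of_eventuallyEq ?_
    filter_upwards [hnhds t ht] with r hr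
    rw [hM r hr, intervalIntegral.integral_const_mul]
  obtain ⟨C, hC⟩ := isCompact_Icc.exists_bound_of_continuousOn hMc
  have hQ0 : Q 0 = 0 := by simp [hQ]
  -- If `h 0 = 0` the quotient `Q / h` is `0 / 0` at time `0`. Monotonicity of `h` bounds it by a
  -- multiple of `h t * t`, so it tends to `0`, the value that division by zero assigns there.
  have hQb : ∀ t ∈ Set.Icc 0 T, |Q t / h t| ≤ u ^ 2 * C * h t * t := by
    intro t ht
    have hht := hp.zero_le ht.1
    have h1 : ‖Q t‖ ≤ u ^ 2 * (h t ^ 2 * C) * |t - 0| := by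
      refine intervalIntegral.norm_integral_le_of_norm_le_const fun s hs => ?_
      rw [Set.uIoc_of_le ht.1] at hs
      have hs0 := hp.zero_le hs.1.le
      have hst : h s ≤ h t := hp.monotoneOn hs.1.le ht.1 hs.2
      rw [norm_mul, norm_mul, norm_pow, norm_pow, Real.norm_eq_abs, Real.norm_eq_abs, sq_abs,
        sq_abs]
      have := hC s ⟨hs.1.le, hs.2.trans ht.2⟩
      gcongr
    rw [sub_zero, abs_of_nonneg ht.1, Real.norm_eq_abs] at h1
    rcases hht.eq_or_lt with h0 | h0
    · simp [← h0]
    · rw [abs_div, abs_of_pos h0, div_le_iff₀ h0]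
      calc |Q t| ≤ u ^ 2 * (h t ^ 2 * C) * t := h1
        _ = u ^ 2 * C * h t * t * h t := by ring
  have hQhc : ContinuousOn (fun t => Q t / h t) (Set.Icc 0 T) := by
    intro t ht
    rcases ht.1.eq_or_lt with rfl | h0
    · have hlim : Tendsto (fun t => u ^ 2 * C * h t * t) (𝓝[Set.Icc 0 T] 0) (𝓝 0) := by
        have : Tendsto (fun t => u ^ 2 * C * h t * t) (𝓝 0) (𝓝 (u ^ 2 * C * h 0 * 0)) :=
          (by fun_prop : Continuous fun t => u ^ 2 * C * h t * t).tendsto 0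
        rw [mul_zero] at this
        exact this.mono_left nhdsWithin_le_nhds
      have : Tendsto (fun t => Q t / h t) (𝓝[Set.Icc 0 T] 0) (𝓝 0) := by
        refine squeeze_zero_norm' ?_ hlim
        filter_upwards [self_mem_nhdsWithin] with t ht using hQb t ht
      rw [ContinuousWithinAt, hQ0, zero_div]
      exact this
    · exact (hQc t ht).div hhc.continuousWithinAt (hp.pos t h0).ne'
  have hA : ∀ t ∈ Set.Ioo 0 T, HasDerivAt (fun t => h t * M t) (Q t / h t + h' t * M t) t := by
    intro t ht
    have := (hp.pos t ht.1).ne'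
    refine ((hp.deriv t).mul (hWm t ht)).congr_deriv ?_
    field_simp
    ring
  have hB : ∀ t ∈ Set.Ioo 0 T,
      HasDerivAt (fun t => Q t / h t + h' t * M t) (κ ^ 2 * (h t * M t)) t := by
    intro t ht
    have := (hp.pos t ht.1).ne'
    refine (((hQd t ht).div (hp.deriv t) this).add
      ((hp.deriv_deriv t).mul (hWm t ht))).congr_deriv ?_
    rw [hκ2]
    field_simp
    ring
  have hcosh := fun t => hasDerivAt_cosh_mul κ t
  have hsinh := fun t => hasDerivAt_sinh_mul κ t
  have hAc : ContinuousOn (fun t => h t * M t) (Set.Icc 0 T) := hhc.continuousOn.mul hMc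
  have hBc : ContinuousOn (fun t => Q t / h t + h' t * M t) (Set.Icc 0 T) :=
    hQhc.add (hp.continuous_deriv.continuousOn.mul hMc)
  have hcc : ContinuousOn (fun t => Real.cosh (κ * t)) (Set.Icc 0 T) := by fun_prop
  have hsc : ContinuousOn (fun t => Real.sinh (κ * t)) (Set.Icc 0 T) := by fun_prop
  -- `A cosh κt - B sinh κt / κ` and `B cosh κt - κ A sinh κt` have derivative zero on the open
  -- interval, so by the mean value theorem they keep their initial values `h 0` and `h' 0`. Solving
  -- for `A T` uses `cosh² - sinh² = 1`.
  obtain ⟨t₁, ht₁, e1⟩ := exists_hasDerivAt_eq_slope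
    (fun t => h t * M t * Real.cosh (κ * t) -
      (Q t / h t + h' t * M t) * (Real.sinh (κ * t) / κ)) (fun _ => 0) hT
    ((hAc.mul hcc).sub (hBc.mul (hsc.div_const κ))) fun t ht => by
      refine (((hA t ht).mul (hcosh t)).sub ((hB t ht).mul ((hsinh t).div_const κ))).congr_deriv ?_
      field_simp
      ring
  obtain ⟨t₂, ht₂, e2⟩ := exists_hasDerivAt_eq_slope
    (fun t => (Q t / h t + h' t * M t) * Real.cosh (κ * t) -
      κ * (h t * M t * Real.sinh (κ * t))) (fun _ => 0) hT
    ((hBc.mul hcc).sub (continuousOn_const.mul (hAc.mul hsc))) fun t ht => by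
      refine (((hB t ht).mul (hcosh t)).sub
        (((hA t ht).mul (hsinh t)).const_mul κ)).congr_deriv ?_
      ring
  have hT' : T - 0 ≠ 0 := by linarith
  have hM0 : M 0 = 1 := by rw [hM 0 ⟨le_rfl, hT.le⟩]; simp
  rw [eq_div_iff hT', zero_mul] at e1 e2
  simp only [hQ0, hM0, mul_zero, Real.cosh_zero, Real.sinh_zero, zero_div, zero_add,
    mul_one, sub_zero] at e1 e2
  have hcs := Real.cosh_sq_sub_sinh_sq (κ * T)
  have f1 := eq_of_sub_eq_zero e1.symm
  have f2 := eq_of_sub_eq_zero e2.symm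
  rw [← f1, ← f2]
  field_simp
  linear_combination (-(κ * h T * M T)) * hcs

end IsRateProfile

/-! ### The two kinds of behaviour at time zero -/

section Regular

variable {Ω : Type*} [MeasurableSpace Ω] {P : Measure Ω}
  {rate : ℝ → ℝ} {S : Ω → Set ℝ} {V : ℝ → Ω → ℝ}

/-- A symmetric direction process whose displacement up to time `s` is independent of the
reversals after `s`, in the sense of exponential moments. -/
structure IsRegularDirection (P : Measure Ω) (S : Ω → Set ℝ) (V : ℝ → Ω → ℝ) : Prop where
  measurable : ∀ s, Measurable (V s)
  path : ∀ᵐ ω ∂P, IsDirectionPath (S ω) fun r => V r ω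
  factorization : ∀ (s t u : ℝ), 0 < s → s ≤ t →
    ∫ ω, (-1 : ℝ) ^ count S s t ω * Real.exp (u * ∫ r in (0 : ℝ)..s, V r ω) ∂P =
      (∫ ω, (-1 : ℝ) ^ count S s t ω ∂P) * ∫ ω, Real.exp (u * ∫ r in (0 : ℝ)..s, V r ω) ∂P
  mean_zero : ∀ t, 0 < t → ∫ ω, V t ω ∂P = 0

theorem integral_eq_zero_of_symmetric_sign [IsProbabilityMeasure P] {U A : Ω → ℝ}
    (hU : Measurable U) (h1 : P {ω | U ω = 1} = 1 / 2) (h2 : P {ω | U ω = -1} = 1 / 2)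
    (hA : Integrable A P) (hUA : IndepFun U A P) : ∫ ω, U ω * A ω ∂P = 0 := by
  rw [integral_eq_of_symmetric_sign hU h1 h2 hA hA.neg hUA
    (hUA.comp measurable_id measurable_neg) (fun ω h => by rw [h, one_mul])
    (fun ω h => by rw [h, neg_one_mul, Pi.neg_apply])]
  simp only [Pi.neg_apply, integral_neg]
  ring

theorem IsDirectionPath.abs_integral_le {S : Set ℝ} {V : ℝ → ℝ} (h : IsDirectionPath S V)
    {a b : ℝ} (ha : 0 ≤ a) (hab : a ≤ b) : |∫ r in a..b, V r| ≤ b - a := by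
  have := intervalIntegral.norm_integral_le_of_norm_le_const (a := a) (b := b) (C := 1) (f := V)
    fun r hr => by
      rw [Set.uIoc_of_le hab] at hr
      exact (h.abs_eq_one (ha.trans_lt hr.1)).le
  rwa [one_mul, abs_of_nonneg (sub_nonneg.2 hab)] at this

theorem IsDirectionPath.continuousOn_integral {S : Set ℝ} {V : ℝ → ℝ} (h : IsDirectionPath S V)
    (T : ℝ) : ContinuousOn (fun t => ∫ r in (0 : ℝ)..t, V r) (Set.Icc 0 T) := by
  rcases le_total 0 T with hT | hT
  · have := intervalIntegral.continuousOn_primitive_interval'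
      (h.intervalIntegrable le_rfl hT) Set.left_mem_uIcc
    rwa [Set.uIcc_of_le hT] at this
  · rcases hT.lt_or_eq with h' | rfl
    · simp [Set.Icc_eq_empty_of_lt h']
    · simp

/-- Signs hold almost surely at the countably many times `1 / (n + 1)` and are carried to all later
times by the reversals. The factorisation holds for displacements on `(e, s]` with `e > 0` and
passes to the limit `e → 0` by dominated convergence. -/
theorem IsDirection.isRegularDirection_Ioi [IsProbabilityMeasure P]
    (hS : IsPoissonProcess P rate S) (hV : IsDirection P (Set.Ioi 0) S V) :
    IsRegularDirection P S V := by
  have hsign : ∀ᵐ ω ∂P, ∀ n : ℕ, V (1 / ((n : ℝ) + 1)) ω = 1 ∨ V (1 / ((n : ℝ) + 1)) ω = -1 :=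
    ae_all_iff.2 fun n =>
      have hn : (0 : ℝ) < 1 / ((n : ℝ) + 1) := by positivity
      ae_eq_one_or_neg_one (hV.measurable _) (hV.forward _ hn) (hV.backward _ hn)
  have hpath : ∀ᵐ ω ∂P, IsDirectionPath (S ω) fun r => V r ω := by
    filter_upwards [hsign, hV.reversal, hS.locally_finite] with ω h1 h2 h3
    refine ⟨h3, fun s hs => ?_, fun s t hs hst => h2 s hs t hst⟩
    obtain ⟨n, hn⟩ := exists_nat_one_div_lt hs
    have hn0 : (0 : ℝ) < 1 / ((n : ℝ) + 1) := by positivity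
    rw [h2 _ hn0 s hn.le]
    rcases h1 n with h | h <;>
      rcases neg_one_pow_eq_or ℝ (count S (1 / ((n : ℝ) + 1)) s ω) with h' | h' <;>
      rw [h, h'] <;> norm_num
  refine ⟨hV.measurable, hpath, fun s t u hs hst => ?_, fun t ht => ?_⟩
  -- The denominator `n + 2` keeps the starting time strictly below `s` also for `n = 0`.
  · have he : ∀ n : ℕ, 0 < s / ((n : ℝ) + 2) ∧ s / ((n : ℝ) + 2) < s := fun n => by
      refine ⟨by positivity, div_lt_self hs ?_⟩
      have : (0 : ℝ) ≤ n := by positivity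
      linarith
    have hlim0 : Tendsto (fun n : ℕ => s / ((n : ℝ) + 2)) atTop (𝓝[Set.Icc 0 s] 0) := by
      refine tendsto_nhdsWithin_iff.2
        ⟨?_, Eventually.of_forall fun n => ⟨(he n).1.le, (he n).2.le⟩⟩
      exact tendsto_const_nhds.div_atTop
        (tendsto_atTop_add_const_right _ _ tendsto_natCast_atTop_atTop)
    have hfac := fun n : ℕ => integral_neg_one_pow_mul_exp_integral hS hV (he n).1 (he n).1.le
      (he n).2 hst hpath (hS.locally_finite.mono fun ω hω => hω _ _ (he n).1) u
    have hNm : AEMeasurable (fun ω => (-1 : ℝ) ^ count S s t ω) P :=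
      (measurable_of_countable fun k : ℕ => (-1 : ℝ) ^ k).comp_aemeasurable
        (hS.aemeasurable_count hs hst)
    have hlim : ∀ᵐ ω ∂P, Tendsto (fun n : ℕ =>
        Real.exp (u * ∫ r in (s / ((n : ℝ) + 2))..s, V r ω)) atTop
        (𝓝 (Real.exp (u * ∫ r in (0 : ℝ)..s, V r ω))) := by
      filter_upwards [hpath] with ω hω
      refine (Real.continuous_exp.tendsto _).comp (Tendsto.const_mul u ?_)
      have h1 := ((hω.continuousOn_integral s) 0 ⟨le_rfl, hs.le⟩).tendsto.comp hlim0
      rw [intervalIntegral.integral_same] at h1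
      have h2 := (tendsto_const_nhds (x := ∫ r in (0 : ℝ)..s, V r ω)).sub h1
      rw [sub_zero] at h2
      refine h2.congr fun n => ?_
      exact intervalIntegral.integral_interval_sub_left (hω.intervalIntegrable le_rfl hs.le)
        (hω.intervalIntegrable le_rfl (he n).1.le)
    have hb : ∀ n : ℕ, ∀ᵐ ω ∂P, ‖Real.exp (u * ∫ r in (s / ((n : ℝ) + 2))..s, V r ω)‖ ≤
        Real.exp (|u| * s) := fun n => by
      filter_upwards [hpath] with ω hω
      rw [Real.norm_eq_abs, Real.abs_exp]
      refine exp_mul_le_of_abs_le ((hω.abs_integral_le (he n).1.le (he n).2.le).trans ?_)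
      linarith [(he n).1]
    have l1 := tendsto_integral_of_dominated_convergence (fun _ => Real.exp (|u| * s))
      (fun n => (hfac n).1) (integrable_const _) hb hlim
    have l2 := tendsto_integral_of_dominated_convergence (fun _ => Real.exp (|u| * s))
      (F := fun (n : ℕ) ω => (-1 : ℝ) ^ count S s t ω *
        Real.exp (u * ∫ r in (s / ((n : ℝ) + 2))..s, V r ω))
      (fun n => hNm.aestronglyMeasurable.mul (hfac n).1) (integrable_const _)
      (fun n => by
        filter_upwards [hb n] with ω hω
        rwa [norm_mul, Real.norm_eq_abs, abs_neg_one_pow_eq_one, one_mul])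
      (by filter_upwards [hlim] with ω hω using hω.const_mul _)
    refine tendsto_nhds_unique l2 ?_
    exact (l1.const_mul (∫ ω, (-1 : ℝ) ^ count S s t ω ∂P)).congr fun n => (hfac n).2.symm
  · have := integral_eq_zero_of_symmetric_sign (hV.measurable t) (hV.forward t ht)
      (hV.backward t ht) (integrable_const (1 : ℝ)) (indepFun_const_right _ _)
    simpa using this

/-- If the total rate near time `0` is finite then almost surely there are no events immediately
after time `0`. -/
theorem IsPoissonProcess.ae_exists_inter_Ioc_eq_empty [IsProbabilityMeasure P] {lam : ℝ}
    {h h' : ℝ → ℝ} (hp : IsRateProfile lam rate h h') (h0 : 0 < h 0)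
    (hS : IsPoissonProcess P rate S) : ∀ᵐ ω ∂P, ∃ d > 0, S ω ∩ Set.Ioc 0 d = ∅ := by
  -- The probability is `1 - h a / h b`; the bound with `h 0` is uniform in `a`, so it survives `a →
  -- 0` and then tends to `0` as `b → 0`.
  have hcount : ∀ a b, 0 < a → a ≤ b →
      P {ω | (S ω ∩ Set.Ioc a b).Nonempty} ≤ ENNReal.ofReal (1 - h 0 / h b) := by
    intro a b ha hab
    have hb := hp.pos b (ha.trans_le hab)
    have e1 : P {ω | (S ω ∩ Set.Ioc a b).Nonempty} = P {ω | count S a b ω ≠ 0} := by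
      refine measure_congr ?_
      filter_upwards [hS.locally_finite] with ω hω
      refine propext ?_
      change (S ω ∩ Set.Ioc a b).Nonempty ↔ (S ω ∩ Set.Ioc a b).ncard ≠ 0
      rw [Ne, Set.ncard_eq_zero (hω a b ha), Set.nonempty_iff_ne_empty]
    have e2 : {n : ℕ | n ≠ 0} = {0}ᶜ := rfl
    rw [e1, (hS.poisson_law a b ha hab).measure_eq (p := fun n => n ≠ 0) (by simp), e2,
      prob_compl_eq_one_sub (measurableSet_singleton 0), poissonMeasure_singleton,
      Real.coe_toNNReal _ (hp.integral_rate_nonneg ha hab), pow_zero, mul_one, Nat.factorial_zero,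
      Nat.cast_one, div_one, hp.exp_neg_integral_rate ha hab,
      ENNReal.ofReal_sub _ (div_nonneg h0.le hb.le), ENNReal.ofReal_one]
    refine tsub_le_tsub_left (ENNReal.ofReal_le_ofReal ?_) 1
    gcongr
    exact hp.monotoneOn Set.self_mem_Ici ha.le ha.le
  have hunion : ∀ b, 0 < b →
      P {ω | (S ω ∩ Set.Ioc 0 b).Nonempty} ≤ ENNReal.ofReal (1 - h 0 / h b) := by
    intro b hb
    have hset : {ω | (S ω ∩ Set.Ioc 0 b).Nonempty} =
        ⋃ n : ℕ, {ω | (S ω ∩ Set.Ioc (b / ((n : ℝ) + 1)) b).Nonempty} := by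
      ext ω
      simp only [Set.mem_ofPred_eq, Set.mem_iUnion]
      constructor
      · rintro ⟨p, hpS, hp0, hpb⟩
        obtain ⟨n, hn⟩ := exists_nat_one_div_lt (div_pos hp0 hb)
        refine ⟨n, p, hpS, ?_, hpb⟩
        rw [lt_div_iff₀ hb] at hn
        rwa [div_eq_mul_one_div, mul_comm]
      · rintro ⟨n, p, hpS, hp0, hpb⟩
        exact ⟨p, hpS, (by positivity : 0 < b / ((n : ℝ) + 1)).trans hp0, hpb⟩
    have hmono : Monotone fun n : ℕ => {ω | (S ω ∩ Set.Ioc (b / ((n : ℝ) + 1)) b).Nonempty} := by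
      intro n m hnm ω hω
      have : (n : ℝ) ≤ m := by exact_mod_cast hnm
      exact hω.mono (Set.inter_subset_inter_right _ (Set.Ioc_subset_Ioc_left (by gcongr)))
    rw [hset, hmono.directed_le.measure_iUnion]
    refine iSup_le fun n => hcount _ _ (by positivity) (div_le_self hb.le ?_)
    have : (0 : ℝ) ≤ n := by positivity
    linarith
  rw [ae_iff]
  have hlim : Tendsto (fun n : ℕ => ENNReal.ofReal (1 - h 0 / h (1 / ((n : ℝ) + 1)))) atTop
      (𝓝 0) := by
    have h1 : Tendsto (fun n : ℕ => h (1 / ((n : ℝ) + 1))) atTop (𝓝 (h 0)) :=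
      (hp.continuous.tendsto 0).comp tendsto_one_div_add_atTop_nhds_zero_nat
    have h2 := (tendsto_const_nhds (x := (1 : ℝ))).sub
      ((tendsto_const_nhds (x := h 0)).div h1 h0.ne')
    rw [div_self h0.ne', sub_self] at h2
    simpa using ENNReal.tendsto_ofReal h2
  refine le_antisymm (ge_of_tendsto' hlim fun n => ?_) zero_le
  refine (measure_mono fun ω hω => ?_).trans (hunion (1 / ((n : ℝ) + 1)) (by positivity))
  by_contra hne
  exact hω ⟨1 / ((n : ℝ) + 1), by positivity, Set.not_nonempty_iff_eq_empty.1 hne⟩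

/-- Almost surely no event lies near time `0`, so counts from `0` are finite and additive and `0`
can serve as reference time. For the mean, independence is given only for counts from positive
times: `V 0 * (-1)^N(t/(n+1), t]` has mean zero and eventually equals `V t`. -/
theorem IsDirection.isRegularDirection_zero [IsProbabilityMeasure P] {lam : ℝ} {h h' : ℝ → ℝ}
    (hp : IsRateProfile lam rate h h') (h0 : 0 < h 0)
    (hS : IsPoissonProcess P rate S) (hV : IsDirection P {0} S V) :
    IsRegularDirection P S V := by
  have hempty := hS.ae_exists_inter_Ioc_eq_empty hp h0
  have hfin : ∀ᵐ ω ∂P, ∀ b, (S ω ∩ Set.Ioc 0 b).Finite := by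
    filter_upwards [hempty, hS.locally_finite] with ω ⟨d, hd, hω⟩ hω' b
    refine (hω' d b hd).subset fun p hpp => ⟨hpp.1, ?_, hpp.2.2⟩
    by_contra hle
    exact Set.eq_empty_iff_forall_notMem.1 hω p ⟨hpp.1, hpp.2.1, not_lt.1 hle⟩
  have hsign := ae_eq_one_or_neg_one (hV.measurable 0) (hV.forward 0 rfl) (hV.backward 0 rfl)
  have hpath : ∀ᵐ ω ∂P, IsDirectionPath (S ω) fun r => V r ω := by
    filter_upwards [hsign, hV.reversal, hS.locally_finite, hfin] with ω h1 h2 h3 h4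
    refine ⟨h3, fun s hs => ?_, fun s t hs hst => ?_⟩
    · rw [h2 0 rfl s hs.le]
      rcases h1 with h | h <;>
        rcases neg_one_pow_eq_or ℝ (count S 0 s ω) with h' | h' <;> simp [h, h']
    · rw [h2 0 rfl t (hs.le.trans hst), h2 0 rfl s hs.le, mul_assoc, ← pow_add]
      simp only [count]
      rw [ncard_inter_Ioc_add hs.le hst (h4 t)]
  refine ⟨hV.measurable, hpath, fun s t u hs hst =>
    (integral_neg_one_pow_mul_exp_integral hS hV rfl le_rfl hs hst hpath
      (hfin.mono fun ω hω => hω s) u).2, fun t ht => ?_⟩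
  have he : ∀ n : ℕ, 0 < t / ((n : ℝ) + 1) ∧ t / ((n : ℝ) + 1) ≤ t := fun n => by
    refine ⟨by positivity, div_le_self ht.le ?_⟩
    have : (0 : ℝ) ≤ n := by positivity
    linarith
  have hNm : ∀ n : ℕ, AEMeasurable (fun ω => (-1 : ℝ) ^ count S (t / ((n : ℝ) + 1)) t ω) P :=
    fun n => (measurable_of_countable fun k : ℕ => (-1 : ℝ) ^ k).comp_aemeasurable
      (hS.aemeasurable_count (he n).1 (he n).2)
  have hzero : ∀ n : ℕ, ∫ ω, V 0 ω * (-1 : ℝ) ^ count S (t / ((n : ℝ) + 1)) t ω ∂P = 0 := by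
    intro n
    refine integral_eq_zero_of_symmetric_sign (hV.measurable 0) (hV.forward 0 rfl)
      (hV.backward 0 rfl) (Integrable.of_bound (hNm n).aestronglyMeasurable 1
        (ae_of_all _ fun ω => (abs_neg_one_pow_eq_one _).le)) ?_
    let q : {q : ℝ × ℝ // 0 < q.1 ∧ q.1 ≤ q.2} := ⟨(t / ((n : ℝ) + 1), t), he n⟩
    exact (hV.indep 0 rfl).comp measurable_id
      ((measurable_of_countable fun k : ℕ => (-1 : ℝ) ^ k).comp (measurable_pi_apply q))
  have hlim := tendsto_integral_of_dominated_convergence (μ := P) (fun _ => (1 : ℝ))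
    (F := fun (n : ℕ) ω => V 0 ω * (-1 : ℝ) ^ count S (t / ((n : ℝ) + 1)) t ω) (f := V t)
    (fun n => (hV.measurable 0).aestronglyMeasurable.mul (hNm n).aestronglyMeasurable)
    (integrable_const _)
    (fun n => by
      filter_upwards [hsign] with ω hω
      rw [norm_mul, Real.norm_eq_abs, Real.norm_eq_abs, abs_neg_one_pow_eq_one, mul_one]
      rcases hω with h | h <;> simp [h])
    (by
      filter_upwards [hempty, hV.reversal, hfin] with ω ⟨d, hd, hω⟩ hrev hω'
      refine tendsto_const_nhds.congr' ?_
      have hd' : Tendsto (fun n : ℕ => t / ((n : ℝ) + 1)) atTop (𝓝 0) :=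
        tendsto_const_nhds.div_atTop
          (tendsto_atTop_add_const_right _ _ tendsto_natCast_atTop_atTop)
      filter_upwards [hd'.eventually_lt_const hd] with n hn
      rw [hrev 0 rfl t ht.le]
      simp only [count]
      rw [← ncard_inter_Ioc_add (he n).1.le (he n).2 (hω' t)]
      have : S ω ∩ Set.Ioc 0 (t / ((n : ℝ) + 1)) = ∅ := Set.subset_eq_empty
        (Set.inter_subset_inter_right _ (Set.Ioc_subset_Ioc_right hn.le)) hω
      rw [this, Set.ncard_empty, zero_add])
  simp_rw [hzero] at hlim
  exact tendsto_nhds_unique hlim tendsto_const_nhds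

end Regular

/-! ### Exponential moments of the displacement, and uniqueness -/

section

variable {Ω : Type*} [MeasurableSpace Ω] {P : Measure Ω}
  {rate : ℝ → ℝ} {S : Ω → Set ℝ} {V : ℝ → Ω → ℝ}

/-- The fundamental theorem for right derivatives, since the direction is only right-continuous. -/
theorem IsDirectionPath.exp_integral_eq {S : Set ℝ} {V : ℝ → ℝ} (h : IsDirectionPath S V)
    (u : ℝ) {t : ℝ} (ht : 0 ≤ t) :
    Real.exp (u * ∫ r in (0 : ℝ)..t, V r) =
      1 + u * ∫ s in (0 : ℝ)..t, V s * Real.exp (u * ∫ r in (0 : ℝ)..s, V r) := by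
  have hc : ContinuousOn (fun s => Real.exp (u * ∫ r in (0 : ℝ)..s, V r)) (Set.Icc 0 t) :=
    Real.continuous_exp.comp_continuousOn (continuousOn_const.mul (h.continuousOn_integral t))
  have hi : IntervalIntegrable (fun s => V s * Real.exp (u * ∫ r in (0 : ℝ)..s, V r)) volume 0 t :=
    (h.intervalIntegrable le_rfl ht).mul_continuousOn (by rwa [Set.uIcc_of_le ht])
  have := intervalIntegral.integral_eq_sub_of_hasDeriv_right (a := 0) (b := t)
    (f := fun s => Real.exp (u * ∫ r in (0 : ℝ)..s, V r))
    (f' := fun s => u * (V s * Real.exp (u * ∫ r in (0 : ℝ)..s, V r)))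
    (by rwa [Set.uIcc_of_le ht]) (fun s hs => by
      rw [min_eq_left ht] at hs
      have hs0 : 0 < s := hs.1
      have hd : HasDerivWithinAt (fun q => ∫ r in (0 : ℝ)..q, V r) (V s) (Set.Ici s) s :=
        intervalIntegral.integral_hasDerivWithinAt_right (h.intervalIntegrable le_rfl hs0.le)
          (t := Set.Ioi s)
          ⟨Set.Ioi 0, mem_nhdsWithin_of_mem_nhds (Ioi_mem_nhds hs0), h.aestronglyMeasurable⟩
          (h.tendsto_right hs0)
      refine (((hd.mono Set.Ioi_subset_Ici_self).const_mul u).exp).congr_deriv ?_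
      ring) (hi.const_mul u)
  rw [intervalIntegral.integral_const_mul] at this
  rw [this]
  simp

/-- Taking expectations in the path identity for `exp(u Z_t)` gives `M = 1 + u ∫ W`. Multiplied by
`V t`, the identity contains `V t * V s = (-1)^N(s, t]`; the factorisation, the mean `(h s / h t)²`
of this sign and `E V_t = 0` give the equation for `W`. -/
theorem IsRegularDirection.integral_exp [IsProbabilityMeasure P] {lam : ℝ} {h h' : ℝ → ℝ}
    (hV : IsRegularDirection P S V) (hS : IsPoissonProcess P rate S)
    (hp : IsRateProfile lam rate h h') (hlam : 0 < lam) {T : ℝ} (hT : 0 < T) {Z : ℝ → Ω → ℝ}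
    (hZm : ∀ s, Measurable (Z s))
    (hZ : ∀ᵐ ω ∂P, ∀ t ∈ Set.Icc 0 T, Z t ω = ∫ s in (0 : ℝ)..t, V s ω) (u : ℝ) :
    h T * ∫ ω, Real.exp (u * Z T ω) ∂P =
      h 0 * Real.cosh (Real.sqrt (u ^ 2 + lam ^ 2) * T) +
        h' 0 * Real.sinh (Real.sqrt (u ^ 2 + lam ^ 2) * T) / Real.sqrt (u ^ 2 + lam ^ 2) := by
  set F : ℝ → Ω → ℝ := fun s ω => V s ω * Real.exp (u * Z s ω) with hF
  have hFm : ∀ s, Measurable (F s) := fun s =>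
    (hV.measurable s).mul (Real.measurable_exp.comp ((hZm s).const_mul u))
  have hright : ∀ᵐ ω ∂P, ∀ s ∈ Set.Ioo 0 T, Tendsto (fun r => F r ω) (𝓝[>] s) (𝓝 (F s ω)) := by
    filter_upwards [hZ, hV.path] with ω hω hpath s hs
    refine (hpath.tendsto_right hs.1).mul ((Real.continuous_exp.tendsto _).comp
      (Tendsto.const_mul u ?_))
    have hnhds : Set.Icc 0 T ∈ 𝓝 s := Icc_mem_nhds hs.1 hs.2
    have h1 : ContinuousOn (fun r => Z r ω) (Set.Icc 0 T) :=
      (hpath.continuousOn_integral T).congr hω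
    exact (h1.continuousAt hnhds).tendsto.mono_left nhdsWithin_le_nhds
  have hexp : ∀ᵐ ω ∂P, ∀ s ∈ Set.Icc 0 T, Real.exp (u * Z s ω) ≤ Real.exp (|u| * T) := by
    filter_upwards [hZ, hV.path] with ω hω hpath s hs
    rw [hω s hs]
    refine exp_mul_le_of_abs_le ((hpath.abs_integral_le le_rfl hs.1).trans ?_)
    linarith [hs.2]
  have hFb : ∀ᵐ ω ∂P, ∀ s ∈ Set.Ioo 0 T, ‖F s ω‖ ≤ Real.exp (|u| * T) := by
    filter_upwards [hexp, hV.path] with ω hω hpath s hs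
    rw [hF, norm_mul, Real.norm_eq_abs, Real.norm_eq_abs, Real.abs_exp, hpath.abs_eq_one hs.1,
      one_mul]
    exact hω s (Set.Ioo_subset_Icc_self hs)
  have hFint : ∀ t ∈ Set.Ioc 0 T,
      Integrable (Function.uncurry F) ((volume.restrict (Set.uIoc 0 t)).prod P) := by
    intro t ht
    -- The right endpoint is dropped because `Z` is not controlled after `T`, so right-continuity
    -- could fail there.
    rw [Set.uIoc_of_le ht.1.le, ← restrict_Ioo_eq_restrict_Ioc]
    have hsub : Set.Ioo 0 t ⊆ Set.Ioo 0 T := Set.Ioo_subset_Ioo_right ht.2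
    refine Integrable.of_bound (aestronglyMeasurable_of_right_continuous hFm measurableSet_Ioo
      (hright.mono fun ω hω s hs => hω s (hsub hs))) (Real.exp (|u| * T)) ?_
    have h1 : ∀ᵐ q ∂((volume.restrict (Set.Ioo 0 t)).prod P), q.1 ∈ Set.Ioo 0 t :=
      Measure.quasiMeasurePreserving_fst.ae (ae_restrict_mem measurableSet_Ioo)
    have h2 := Measure.quasiMeasurePreserving_snd (μ := volume.restrict (Set.Ioo 0 t)) |>.ae hFb
    filter_upwards [h1, h2] with q hq1 hq2
    exact hq2 q.1 (hsub hq1)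
  have hpathF : ∀ᵐ ω ∂P, ∀ t ∈ Set.Icc 0 T,
      Real.exp (u * Z t ω) = 1 + u * ∫ s in (0 : ℝ)..t, F s ω := by
    filter_upwards [hZ, hV.path] with ω hω hpath t ht
    rw [hω t ht, hpath.exp_integral_eq u ht.1]
    congr 2
    refine intervalIntegral.integral_congr fun s hs => ?_
    rw [Set.uIcc_of_le ht.1] at hs
    simp only [hF, hω s ⟨hs.1, hs.2.trans ht.2⟩]
  have hinner : ∀ t ∈ Set.Ioc 0 T, Integrable (fun ω => ∫ s in (0 : ℝ)..t, F s ω) P := by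
    intro t ht
    have := (hFint t ht).integral_prod_right
    simpa only [intervalIntegral.integral_of_le ht.1.le, Set.uIoc_of_le ht.1.le,
      Function.uncurry_apply_pair] using this
  have hκ : 0 < Real.sqrt (u ^ 2 + lam ^ 2) := Real.sqrt_pos.2 (by positivity)
  refine hp.solution_unique (u := u) (M := fun t => ∫ ω, Real.exp (u * Z t ω) ∂P)
    (W := fun t => ∫ ω, F t ω ∂P) hT hκ (Real.sq_sqrt (by positivity)) ?_ ?_ ?_
  · rw [intervalIntegrable_iff]
    exact (hFint T ⟨hT, le_rfl⟩).integral_prod_left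
  · intro t ht
    rcases ht.1.eq_or_lt with rfl | ht0
    · simp only [intervalIntegral.integral_same, mul_zero, add_zero]
      rw [integral_congr_ae (g := fun _ => (1 : ℝ))]
      · simp
      · filter_upwards [hpathF] with ω hω
        simpa using hω 0 ht
    · rw [intervalIntegral_integral_swap (hFint t ⟨ht0, ht.2⟩), ← integral_const_mul]
      have h1 : (1 : ℝ) = ∫ _, 1 ∂P := by simp
      nth_rewrite 1 [h1]
      rw [← integral_add (integrable_const _) ((hinner t ⟨ht0, ht.2⟩).const_mul u)]
      refine integral_congr_ae ?_
      filter_upwards [hpathF] with ω hω using hω t ht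
  · intro t ht
    have ht' : t ∈ Set.Ioc 0 T := ⟨ht.1, ht.2.le⟩
    have hVb : ∀ᵐ ω ∂P, ‖V t ω‖ ≤ 1 := by
      filter_upwards [hV.path] with ω hω using (hω.abs_eq_one ht.1).le
    have hVi : Integrable (V t) P := Integrable.of_bound (hV.measurable t).aestronglyMeasurable 1 hVb
    have hjoint : Integrable (Function.uncurry fun s ω => V t ω * F s ω)
        ((volume.restrict (Set.uIoc 0 t)).prod P) :=
      (hFint t ht').bdd_mul (c := 1) ((hV.measurable t).comp measurable_snd).aestronglyMeasurable
        (Measure.quasiMeasurePreserving_snd (μ := volume.restrict (Set.uIoc 0 t)) |>.ae hVb)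
    have hstep : ∫ ω, F t ω ∂P = ∫ ω, (V t ω + u * ∫ s in (0 : ℝ)..t, V t ω * F s ω) ∂P := by
      refine integral_congr_ae ?_
      filter_upwards [hpathF] with ω hω
      simp only [intervalIntegral.integral_const_mul]
      rw [hF]
      simp only
      rw [hω t (Set.Ioo_subset_Icc_self ht)]
      ring
    have hinner' : Integrable (fun ω => ∫ s in (0 : ℝ)..t, V t ω * F s ω) P := by
      have := hjoint.integral_prod_right
      simpa only [intervalIntegral.integral_of_le ht.1.le, Set.uIoc_of_le ht.1.le,
      Function.uncurry_apply_pair] using this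
    rw [hstep, integral_add hVi (hinner'.const_mul u), hV.mean_zero t ht.1, zero_add,
      integral_const_mul, ← intervalIntegral_integral_swap hjoint,
      intervalIntegral.integral_of_le ht.1.le, intervalIntegral.integral_of_le ht.1.le,
      integral_Ioc_eq_integral_Ioo, integral_Ioc_eq_integral_Ioo]
    congr 1
    refine setIntegral_congr_fun measurableSet_Ioo fun s hs => ?_
    have hsT : s ∈ Set.Icc 0 T := ⟨hs.1.le, hs.2.le.trans ht.2.le⟩
    have e1 : ∫ ω, V t ω * F s ω ∂P =
        ∫ ω, (-1 : ℝ) ^ count S s t ω * Real.exp (u * ∫ r in (0 : ℝ)..s, V r ω) ∂P := by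
      refine integral_congr_ae ?_
      filter_upwards [hV.path, hZ] with ω hω hω'
      have hsq : V s ω * V s ω = 1 := by rcases hω.sign s hs.1 with h | h <;> rw [h] <;> norm_num
      have hrev := hω.reversal s t hs.1 hs.2.le
      simp only [hF, count]
      rw [hrev, hω' s hsT]
      linear_combination ((-1) ^ (S ω ∩ Set.Ioc s t).ncard *
        Real.exp (u * ∫ r in (0 : ℝ)..s, V r ω)) * hsq
    have e2 : ∫ ω, Real.exp (u * ∫ r in (0 : ℝ)..s, V r ω) ∂P = ∫ ω, Real.exp (u * Z s ω) ∂P := by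
      refine integral_congr_ae ?_
      filter_upwards [hZ] with ω hω
      rw [hω s hsT]
    rw [e1, hV.factorization s t u hs.1 hs.2.le, e2,
      hS.integral_neg_one_pow_count hs.1 hs.2.le (hp.integral_rate_nonneg hs.1 hs.2.le),
      ← hp.exp_neg_integral_rate hs.1 hs.2.le, ← Real.exp_nat_mul]
    congr 2
    push_cast
    ring

/-- A finite measure with bounded support is determined by its exponential moments. -/
theorem ext_of_integral_exp {μ ν : Measure ℝ} [IsProbabilityMeasure μ] [IsFiniteMeasure ν] {C : ℝ}
    (hμ : ∀ᵐ z ∂μ, |z| ≤ C)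
    (h : ∀ u : ℝ, ∫ z, Real.exp (u * z) ∂μ = ∫ z, Real.exp (u * z) ∂ν) : μ = ν := by
  refine Measure.ext_of_complexMGF_id_eq (funext fun z => ?_)
  -- Boundedness is needed for `μ` only: its moments are positive, while the integral of a
  -- non-integrable function is `0`, so equality forces integrability under `ν`.
  refine eqOn_complexMGF_of_mgf (X := id) (Y := id) (funext h) ?_
  have : integrableExpSet id μ = Set.univ := by
    refine Set.eq_univ_of_forall fun u => ?_
    refine Integrable.of_bound (by fun_prop) (Real.exp (|u| * C)) ?_
    filter_upwards [hμ] with y hy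
    rw [Real.norm_eq_abs, Real.abs_exp]
    exact exp_mul_le_of_abs_le hy
  simp [this]

end

/-! ### Identification of the laws -/

section Density

variable {T : ℝ} {g : ℝ → ℝ}

theorem isFiniteMeasure_withDensity_Ioo (hg : Continuous g) :
    IsFiniteMeasure ((volume.restrict (Set.Ioo (-T) T)).withDensity
      fun z => ENNReal.ofReal (g z)) :=
  isFiniteMeasure_withDensity_ofReal
    (hg.integrableOn_Icc.mono_set (Set.Ioo_subset_Icc_self (a := -T) (b := T))).2

theorem integrable_exp_withDensity_Ioo (hg : Continuous g) (u : ℝ) :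
    Integrable (fun z => Real.exp (u * z)) ((volume.restrict (Set.Ioo (-T) T)).withDensity
      fun z => ENNReal.ofReal (g z)) := by
  have := isFiniteMeasure_withDensity_Ioo (T := T) hg
  refine Integrable.of_bound (by fun_prop) (Real.exp (|u| * T)) ?_
  refine (withDensity_absolutelyContinuous _ _).ae_le ?_
  filter_upwards [ae_restrict_mem measurableSet_Ioo] with z hz
  rw [Real.norm_eq_abs, Real.abs_exp]
  exact exp_mul_le_of_abs_le (abs_lt.2 hz).le

theorem integral_exp_withDensity_Ioo (hT : 0 ≤ T) (hg : Continuous g)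
    (hg0 : ∀ z ∈ Set.Ioo (-T) T, 0 ≤ g z) (u : ℝ) :
    ∫ z, Real.exp (u * z) ∂((volume.restrict (Set.Ioo (-T) T)).withDensity
      fun z => ENNReal.ofReal (g z)) = ∫ z in -T..T, Real.exp (u * z) * g z := by
  rw [integral_withDensity_eq_integral_toReal_smul hg.measurable.ennreal_ofReal
    (ae_of_all _ fun z => ENNReal.ofReal_lt_top), intervalIntegral.integral_of_le (by linarith),
    integral_Ioc_eq_integral_Ioo]
  refine setIntegral_congr_fun measurableSet_Ioo fun z hz => ?_
  simp only [smul_eq_mul]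
  rw [ENNReal.toReal_ofReal (hg0 z hz), mul_comm]

end Density

section Laws

variable {Ω : Type*} [MeasurableSpace Ω] {P : Measure Ω}
  {rate c : ℝ → ℝ} {S : Ω → Set ℝ} {V X : ℝ → Ω → ℝ} {I : Set ℝ} {T lam : ℝ}

theorem besselSeries_density_nonneg (m : ℕ) {lam T z : ℝ} (hz : z ∈ Set.Ioo (-T) T) :
    0 ≤ besselSeries m (lam ^ 2 * (T ^ 2 - z ^ 2) / 4) := by
  refine besselSeries_nonneg m ?_
  have : 0 ≤ T ^ 2 - z ^ 2 := by nlinarith [hz.1, hz.2]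
  positivity

theorem continuous_besselSeries_comp (m : ℕ) (lam T : ℝ) :
    Continuous fun z => besselSeries m (lam ^ 2 * (T ^ 2 - z ^ 2) / 4) :=
  (continuous_besselSeries m).comp (by fun_prop)

/-- The law of the travel time from the origin to the position, for the rate `λ tanh λt`. -/
def tanhTravelLaw (lam T : ℝ) : Measure ℝ :=
  (volume.restrict (Set.Ioo (-T) T)).withDensity
      (fun z => ENNReal.ofReal (lam ^ 2 * T / 4 *
        besselSeries 1 (lam ^ 2 * (T ^ 2 - z ^ 2) / 4) / Real.cosh (lam * T)))
    + ENNReal.ofReal (1 / (2 * Real.cosh (lam * T))) • (Measure.dirac (-T) + Measure.dirac T)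

/-- The law of the travel time from the origin to the position, for the rate `λ coth λt`. -/
def cothTravelLaw (lam T : ℝ) : Measure ℝ :=
  (volume.restrict (Set.Ioo (-T) T)).withDensity
    (fun z => ENNReal.ofReal (lam / 2 *
      besselSeries 0 (lam ^ 2 * (T ^ 2 - z ^ 2) / 4) / Real.sinh (lam * T)))

/-- The two atoms contribute `cosh(uT) / cosh(λT)`, exactly what the order-one Bessel density lacks.
-/
theorem integral_exp_tanhTravelLaw (hT : 0 < T) (u : ℝ) :
    Real.cosh (lam * T) * ∫ z, Real.exp (u * z) ∂(tanhTravelLaw lam T) =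
      Real.cosh (Real.sqrt (u ^ 2 + lam ^ 2) * T) := by
  have hc := Real.cosh_pos (lam * T)
  have hg := ((continuous_besselSeries_comp 1 lam T).const_mul (lam ^ 2 * T / 4)).div_const
    (Real.cosh (lam * T))
  have hd : ∀ a : ℝ, Integrable (fun z => Real.exp (u * z)) (Measure.dirac a) := fun a =>
    integrable_dirac (by simp)
  have h1 := integral_exp_mul_besselSeries_one (lam := lam) hT.le u
  rw [tanhTravelLaw, integral_add_measure (integrable_exp_withDensity_Ioo hg u)
    (((hd _).add_measure (hd _)).smul_measure ENNReal.ofReal_ne_top), integral_smul_measure,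
    integral_add_measure (hd _) (hd _), integral_dirac, integral_dirac,
    integral_exp_withDensity_Ioo hT.le hg (fun z hz => by
      have := besselSeries_density_nonneg 1 (lam := lam) hz
      positivity), ENNReal.toReal_ofReal (by positivity), smul_eq_mul]
  have e1 : ∀ z, Real.exp (u * z) * (lam ^ 2 * T / 4 *
      besselSeries 1 (lam ^ 2 * (T ^ 2 - z ^ 2) / 4) / Real.cosh (lam * T)) =
      1 / (2 * Real.cosh (lam * T)) * (Real.exp (u * z) *
        (lam ^ 2 * T / 2 * besselSeries 1 (lam ^ 2 * (T ^ 2 - z ^ 2) / 4))) := fun z => by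
    field_simp
    ring
  simp_rw [e1]
  rw [intervalIntegral.integral_const_mul, h1, Real.cosh_eq (u * T), mul_neg]
  field_simp
  ring

theorem integral_exp_cothTravelLaw (hlam : 0 < lam) (hT : 0 < T) (u : ℝ) :
    Real.sinh (lam * T) * ∫ z, Real.exp (u * z) ∂(cothTravelLaw lam T) =
      lam * Real.sinh (Real.sqrt (u ^ 2 + lam ^ 2) * T) / Real.sqrt (u ^ 2 + lam ^ 2) := by
  have hs : 0 < Real.sinh (lam * T) := Real.sinh_pos_iff.2 (by positivity)
  have hκ : 0 < Real.sqrt (u ^ 2 + lam ^ 2) := Real.sqrt_pos.2 (by positivity)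
  have hg := ((continuous_besselSeries_comp 0 lam T).const_mul (lam / 2)).div_const
    (Real.sinh (lam * T))
  have h1 := integral_exp_mul_besselSeries_zero (lam := lam) hT.le u
  rw [cothTravelLaw, integral_exp_withDensity_Ioo hT.le hg (fun z hz => by
    have := besselSeries_density_nonneg 0 (lam := lam) hz
    positivity)]
  have e1 : ∀ z, Real.exp (u * z) * (lam / 2 *
      besselSeries 0 (lam ^ 2 * (T ^ 2 - z ^ 2) / 4) / Real.sinh (lam * T)) =
      lam / (2 * Real.sinh (lam * T)) * (Real.exp (u * z) *
        besselSeries 0 (lam ^ 2 * (T ^ 2 - z ^ 2) / 4)) := fun z => by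
    field_simp
  simp_rw [e1]
  rw [intervalIntegral.integral_const_mul, eq_div_iff hκ.ne']
  field_simp
  rw [mul_comm, h1, mul_comm T]

theorem isFiniteMeasure_tanhTravelLaw (lam T : ℝ) : IsFiniteMeasure (tanhTravelLaw lam T) := by
  have := isFiniteMeasure_withDensity_Ioo (T := T)
    (((continuous_besselSeries_comp 1 lam T).const_mul (lam ^ 2 * T / 4)).div_const
      (Real.cosh (lam * T)))
  have := (Measure.dirac (-T) + Measure.dirac T).smul_finite
    (c := ENNReal.ofReal (1 / (2 * Real.cosh (lam * T)))) ENNReal.ofReal_ne_top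
  unfold tanhTravelLaw
  infer_instance

theorem isFiniteMeasure_cothTravelLaw (lam T : ℝ) : IsFiniteMeasure (cothTravelLaw lam T) :=
  isFiniteMeasure_withDensity_Ioo
    (((continuous_besselSeries_comp 0 lam T).const_mul (lam / 2)).div_const (Real.sinh (lam * T)))

theorem IsTelegraphProcess.ae_travelTime_eq (hX : IsTelegraphProcess P rate c I T S V X)
    (hV : IsRegularDirection P S V) (hc : Measurable c) (hpos : ∀ x, 0 < c x)
    (hint : ∀ x, IntervalIntegrable (fun w => 1 / c w) volume 0 x) :
    ∀ᵐ ω ∂P, ∀ t ∈ Set.Icc 0 T, travelTime c (X t ω) = ∫ s in (0 : ℝ)..t, V s ω := by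
  filter_upwards [hV.path, hX.motion] with ω hω hm
  exact hω.travelTime_eq hc hpos hint hm

/-- The law of the travel time is determined by its exponential moments. -/
theorem IsTelegraphProcess.map_travelTime_eq [IsProbabilityMeasure P]
    {h h' : ℝ → ℝ}
    (hX : IsTelegraphProcess P rate c I T S V X)
    (hV : IsRegularDirection P S V) (hp : IsRateProfile lam rate h h') (hlam : 0 < lam)
    (hc : Measurable c) (hpos : ∀ x, 0 < c x)
    (hint : ∀ x, IntervalIntegrable (fun w => 1 / c w) volume 0 x) (hT : 0 < T)
    {ν : Measure ℝ} [IsFiniteMeasure ν]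
    (hν : ∀ u : ℝ, h T * ∫ z, Real.exp (u * z) ∂ν =
      h 0 * Real.cosh (Real.sqrt (u ^ 2 + lam ^ 2) * T) +
        h' 0 * Real.sinh (Real.sqrt (u ^ 2 + lam ^ 2) * T) / Real.sqrt (u ^ 2 + lam ^ 2)) :
    (P.map (X T)).map (travelTime c) = ν := by
  have hτ := (continuous_travelTime hint).measurable
  have hZm : ∀ s, Measurable fun ω => travelTime c (X s ω) := fun s => hτ.comp (hX.measurable s)
  have hZ := hX.ae_travelTime_eq hV hc hpos hint
  rw [Measure.map_map hτ (hX.measurable T), Function.comp_def]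
  have : IsProbabilityMeasure (P.map fun ω => travelTime c (X T ω)) :=
    Measure.isProbabilityMeasure_map (hZm T).aemeasurable
  refine ext_of_integral_exp (C := T) ?_ fun u => ?_
  · rw [ae_map_iff (hZm T).aemeasurable
      (measurableSet_le measurable_abs measurable_const)]
    filter_upwards [hZ, hV.path] with ω hω hpath
    rw [hω T ⟨hT.le, le_rfl⟩]
    simpa using hpath.abs_integral_le le_rfl hT.le
  · have e := hV.integral_exp hX.poisson hp hlam hT hZm hZ u
    rw [integral_map (hZm T).aemeasurable (by fun_prop)]
    exact mul_left_cancel₀ (hp.pos T hT).ne' (e.trans (hν u).symm)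

/-- A measure on positions corresponds to a law of travel times on the range of the travel time. -/
theorem eq_restrict_range_of_map_travelTime (hpos : ∀ x, 0 < c x)
    (hint : ∀ x, IntervalIntegrable (fun w => 1 / c w) volume 0 x) {μ ν : Measure ℝ}
    (h : μ.map (travelTime c) = ν) :
    ν (Set.range (travelTime c))ᶜ = 0 ∧ ν.restrict (Set.range (travelTime c)) = ν := by
  have hemb := measurableEmbedding_travelTime hpos hint
  have h0 : ν (Set.range (travelTime c))ᶜ = 0 := by
    rw [← h, hemb.map_apply]
    simp
  exact ⟨h0, Measure.restrict_eq_self_of_ae_mem (mem_ae_iff.2 h0)⟩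

/-- The endpoints come from the law itself: the travel-time law lives on the range of `travelTime c`
and charges `-T` and `T`, so both are attained. Measures on positions may then be compared after
push-forward by the embedding `travelTime c`. -/
theorem IsTelegraphProcess.law_tanh [IsProbabilityMeasure P]
    (hlam : 0 < lam) (hc : Measurable c) (hpos : ∀ x, 0 < c x)
    (hint : ∀ x, IntervalIntegrable (fun w => 1 / c w) volume 0 x) (hT : 0 < T)
    (hX : IsTelegraphProcess P (tanhRate lam) c {0} T S V X) :
    ∃ a b : ℝ, travelTime c a = -T ∧ travelTime c b = T ∧
      P.map (X T) =
        (volume.restrict (support c T)).withDensity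
            (fun x => ENNReal.ofReal (tanhDensity lam c x T))
          + ENNReal.ofReal (1 / (2 * Real.cosh (lam * T))) •
            (Measure.dirac a + Measure.dirac b) := by
  have hp := isRateProfile_tanh hlam
  have hV := IsDirection.isRegularDirection_zero hp (by simp) hX.poisson hX.direction
  have hemb := measurableEmbedding_travelTime hpos hint
  have := isFiniteMeasure_tanhTravelLaw lam T
  have hlaw : (P.map (X T)).map (travelTime c) = tanhTravelLaw lam T :=
    hX.map_travelTime_eq hV hp hlam hc hpos hint hT fun u => by
      simpa using integral_exp_tanhTravelLaw (lam := lam) hT u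
  obtain ⟨h0, hrestr⟩ := eq_restrict_range_of_map_travelTime hpos hint hlaw
  have hm : ENNReal.ofReal (1 / (2 * Real.cosh (lam * T))) ≠ 0 := by
    have := Real.cosh_pos (lam * T)
    exact (ENNReal.ofReal_pos.2 (by positivity)).ne'
  have hms := hemb.measurableSet_range.compl
  have hmem : -T ∈ Set.range (travelTime c) ∧ T ∈ Set.range (travelTime c) := by
    rw [tanhTravelLaw, Measure.add_apply, Measure.smul_apply, Measure.add_apply,
      Measure.dirac_apply' _ hms, Measure.dirac_apply' _ hms, smul_eq_mul] at h0
    have h1 := (mul_eq_zero.1 (add_eq_zero.1 h0).2).resolve_left hm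
    simpa using h1
  obtain ⟨⟨a, ha⟩, b, hb⟩ := hmem
  refine ⟨a, b, ha, hb, hemb.map_injective ?_⟩
  have hg := ((continuous_besselSeries_comp 1 lam T).const_mul (lam ^ 2 * T / 4)).div_const
    (Real.cosh (lam * T))
  classical
  rw [hlaw, Measure.map_add _ _ hemb.measurable, Measure.map_smul,
    Measure.map_add _ _ hemb.measurable, Measure.map_dirac' hemb.measurable,
    Measure.map_dirac' hemb.measurable, ha, hb,
    map_travelTime_withDensity hc hpos hint hg.measurable fun x hx => mul_tanhDensity hpos lam hx,
    ← hrestr]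
  rw [tanhTravelLaw, Measure.restrict_add, Measure.restrict_smul, Measure.restrict_add,
    restrict_dirac' hemb.measurableSet_range,
    restrict_dirac' hemb.measurableSet_range, if_pos ⟨a, ha⟩, if_pos ⟨b, hb⟩]

theorem IsTelegraphProcess.law_coth [IsProbabilityMeasure P]
    (hlam : 0 < lam) (hc : Measurable c) (hpos : ∀ x, 0 < c x)
    (hint : ∀ x, IntervalIntegrable (fun w => 1 / c w) volume 0 x) (hT : 0 < T)
    (hX : IsTelegraphProcess P (cothRate lam) c (Set.Ioi 0) T S V X) :
    P.map (X T) = (volume.restrict (support c T)).withDensity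
      (fun x => ENNReal.ofReal (cothDensity lam c x T)) := by
  have hp := isRateProfile_coth hlam
  have hV := IsDirection.isRegularDirection_Ioi hX.poisson hX.direction
  have hemb := measurableEmbedding_travelTime hpos hint
  have := isFiniteMeasure_cothTravelLaw lam T
  have hlaw : (P.map (X T)).map (travelTime c) = cothTravelLaw lam T :=
    hX.map_travelTime_eq hV hp hlam hc hpos hint hT fun u => by
      simpa using integral_exp_cothTravelLaw hlam hT u
  obtain ⟨-, hrestr⟩ := eq_restrict_range_of_map_travelTime hpos hint hlaw
  refine hemb.map_injective ?_
  have hg := ((continuous_besselSeries_comp 0 lam T).const_mul (lam / 2)).div_const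
    (Real.sinh (lam * T))
  rw [hlaw, map_travelTime_withDensity hc hpos hint hg.measurable fun x hx =>
    mul_cothDensity hpos lam hx, ← hrestr]
  rfl

end Laws

end

end Telegraph

open Telegraph in
theorem mainTheorem8 {Ω : Type*} [MeasurableSpace Ω] (P : Measure Ω) [IsProbabilityMeasure P]
    (lam : ℝ) (hlam : 0 < lam) (c : ℝ → ℝ) (hc : Measurable c) (hpos : ∀ x, 0 < c x)
    (hint : ∀ x, IntervalIntegrable (fun w => 1 / c w) volume 0 x) :
    -- law for the rate `λ tanh λt`
    (∀ (S : Ω → Set ℝ) (V Y : ℝ → Ω → ℝ) (t : ℝ), 0 < t →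
      IsTelegraphProcess P (tanhRate lam) c {0} t S V Y →
      ∃ a b : ℝ, travelTime c a = -t ∧ travelTime c b = t ∧
        P.map (Y t) =
          (volume.restrict (support c t)).withDensity
              (fun x => ENNReal.ofReal (tanhDensity lam c x t))
            + ENNReal.ofReal (1 / (2 * Real.cosh (lam * t))) •
              (Measure.dirac a + Measure.dirac b)) ∧
    -- law for the rate `λ coth λt`
    (∀ (S : Ω → Set ℝ) (V X : ℝ → Ω → ℝ) (t : ℝ), 0 < t →
      IsTelegraphProcess P (cothRate lam) c (Set.Ioi 0) t S V X →
        P.map (X t) =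
          (volume.restrict (support c t)).withDensity
              (fun x => ENNReal.ofReal (cothDensity lam c x t))) ∧
    -- the telegraph equations
    (∀ x t : ℝ, |travelTime c x| < t → (∀ᶠ z in 𝓝 x, ContinuousAt c z) →
      SolvesTelegraphAt (tanhRate lam) c (fun x t => c x * tanhDensity lam c x t) x t ∧
      SolvesForwardTelegraphAt (tanhRate lam) c (tanhDensity lam c) x t ∧
      SolvesTelegraphAt (cothRate lam) c (fun x t => c x * cothDensity lam c x t) x t ∧
      SolvesForwardTelegraphAt (cothRate lam) c (cothDensity lam c) x t) := by
  exact ⟨fun _ _ _ _ ht hY => hY.law_tanh hlam hc hpos hint ht,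
    fun _ _ _ _ ht hX => hX.law_coth hlam hc hpos hint ht,
    fun _ _ ht hx => telegraph_equations hlam hc hpos hint ht hx⟩
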